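/- Let $d\ge 1$ and let $\mathfrak G$ be the set of all bounded subsets of $\mathbb R^d$ of diameter strictly smaller than $1$. Let $\mathcal F$ be a $\sigma$-algebra on $\mathfrak G$ that contains $\{G: G\cap K\ne\emptyset\}$ and $\{G: K\subset G\}$ for every compact $K\subset\mathbb R^d$, and that contains, with every $\mathcal D\in\mathcal F$, the families $x+\mathcal D=\{x+G: G\in\mathcal D\}$ ($x\in\mathbb R^d$) and $\mathcal D_s=\{sG: G\in\mathcal D\}$ ($s>0$, provided that all sets $sG$, $G\in\mathcal D$, have diameter smaller than $1$). Let $\mu$ be a measure on $(\mathfrak G,\mathcal F)$ such that * $\mu(x+\mathcal D)=\mu(\mathcal D)$ for all $\mathcal D\in\mathcal F$ and $x\in\mathbb R^d$; * $\mu(\mathcal D_s)=\mu(\mathcal D)$ whenever $\mathcal D\in\mathcal F$, $\mu(\mathcal D)<\infty$, $s>0$ and all sets in $\mathcal D_s$ have diameter smaller than $1$; * $\mu(G: G\cap A\neq\emptyset,\ \mathrm{diam}(G)\ge\delta)<\infty$ for every bounded $A\subset\mathbb R^d$ and every $\delta>0$; * $\mu(G:\mathcal L(\partial G)>0)=0$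 and $\mu(G:\mathcal L(G)>0)>0$, where $\mathcal L$ is Lebesgue measure. Let $\mathcal A_1=\{G\in\mathfrak G: o\in G,\ 2^{-1}\le \mathrm{diam}(G)<1\}$, let $0<\lambda<\frac{d\log 2}{\mu(\mathcal A_1)}$, let $\Phi_\lambda$ be a Poisson process on $\mathfrak G$ with intensity measure $\lambda\mu$, and let $\varepsilon>0$. For $n\ge 0$ let $\mathcal B_n$ be the set of the $2^{dn}$ closed boxes $2^{-n}(k+[0,1]^d)$, $k\in\{0,\dots,2^n-1\}^d$, and let $$m_n=\{B\in\mathcal B_n:\ \text{no } G\in\Phi_\lambda \text{ with } \mathrm{diam}(G)\ge 2^{-n} \text{ satisfies } B\cap G\ne\emptyset\}.$$ Then, with positive probability, one can embed within $(m_n)$ a supercritical branching process with growth rate at least $2^{\,d-\lambda(\mu(\mathcal A_1)+\varepsilon)/\log 2}$. Precisely, there are an integer $N\ge 1$, a probability distribution $p$ on $\{0,1,2,\dots\}$ with mean $g^N$, where $$g>1\quad\text{and}\quad g\ \ge\ 2^{\,d-\lambda\frac{\mu(\mathcal A_1)+\varepsilon}{\log 2}},$$ and random finite sets of boxes $W_0,W_1,W_2,\dots$,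 defined on the probability space of $\Phi_\lambda$, such that * $W_0=\{[0,1]^d\}$, $W_l\subset m_{lN}$ for every $l\ge0$, and every box in $W_{l+1}$ is contained in a box of $W_l$, its parent; * $(W_l)_{l\ge 0}$ is the family tree of a Galton–Watson branching process with offspring distribution $p$: for every $l$, given $W_0,\dots,W_l$, the numbers of children in $W_{l+1}$ of the boxes $B\in W_l$ are independent with distribution $p$; * with positive probability, $W_l\ne\emptyset$ for all $l$ and $\lim_{l\to\infty}|W_l|^{1/(lN)}=g$. -/

import Mathlib

open MeasureTheory ProbabilityTheory Filter Topology
open scoped ENNReal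

namespace PoissonFractal

/-- `d`-dimensional Euclidean space. -/
abbrev Space (d : ℕ) : Type := EuclideanSpace ℝ (Fin d)

/-- The set `𝔊` of all subsets of `ℝ^d` with diameter strictly smaller than `1`. (Boundedness is
required explicitly because `Metric.diam` of an unbounded set is `0` by convention.) -/
structure SmallSet (d : ℕ) where
  carrier : Set (Space d)
  bounded : Bornology.IsBounded carrier
  diam_lt_one : Metric.diam carrier < 1

variable {d : ℕ}

/-- The diameter of a set in `𝔊`. -/
noncomputable def SmallSet.diam (G : SmallSet d) : ℝ := Metric.diam G.carrier

/-- The sets in `𝔊` that meet `A`. -/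
def hitting (A : Set (Space d)) : Set (SmallSet d) :=
  {G | (G.carrier ∩ A).Nonempty}

/-- The sets in `𝔊` that contain `A`. -/
def covering (A : Set (Space d)) : Set (SmallSet d) :=
  {G | A ⊆ G.carrier}

/-- The sets in `𝔊` of diameter at least `2^{-n}`. -/
noncomputable def atLeast (d n : ℕ) : Set (SmallSet d) :=
  {G | (2 : ℝ) ^ (-(n : ℤ)) ≤ G.diam}

/-- `𝒜_l`: the sets in `𝔊` that contain the origin and satisfy `2^{-l} ≤ diam G < 2^{-l+1}`. -/
noncomputable def originShell (d l : ℕ) : Set (SmallSet d) :=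
  {G | (0 : Space d) ∈ G.carrier ∧ (2 : ℝ) ^ (-(l : ℤ)) ≤ G.diam ∧
    G.diam < (2 : ℝ) ^ (-(l : ℤ) + 1)}

/-- `x + D`, the family of all translates `x + G` with `G ∈ D`. -/
def translateFamily (x : Space d) (D : Set (SmallSet d)) : Set (SmallSet d) :=
  {L | ∃ G ∈ D, L.carrier = (fun y => x + y) '' G.carrier}

/-- `D_s`, the family of all dilates `s G` with `G ∈ D`. -/
def dilateFamily (s : ℝ) (D : Set (SmallSet d)) : Set (SmallSet d) :=
  {L | ∃ G ∈ D, L.carrier = (fun y => s • y) '' G.carrier}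

/-- All dilates `s G` with `G ∈ D` again have diameter smaller than one. -/
def StaysSmall (s : ℝ) (D : Set (SmallSet d)) : Prop :=
  ∀ G ∈ D, Metric.diam ((fun y => s • y) '' G.carrier) < 1

/-- A suitable `σ`-algebra on `𝔊`: it contains the events that a compact set is met, respectively
covered, and is stable under translations and (whenever the result stays in `𝔊`) dilations. -/
class SuitableSigmaAlgebra (d : ℕ) [MeasurableSpace (SmallSet d)] : Prop where
  hitting_mem : ∀ K : Set (Space d), IsCompact K → MeasurableSet (hitting K)
  covering_mem : ∀ K : Set (Space d), IsCompact K → MeasurableSet (covering K)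
  translate_mem : ∀ (x : Space d) (D : Set (SmallSet d)), MeasurableSet D →
    MeasurableSet (translateFamily x D)
  dilate_mem : ∀ (s : ℝ) (D : Set (SmallSet d)), 0 < s → MeasurableSet D → StaysSmall s D →
    MeasurableSet (dilateFamily s D)

/-- A translation invariant and semi scale invariant measure on `𝔊` that satisfies the three
regularity assumptions: local finiteness, null boundaries, and positive mass on sets of positive
volume. -/
structure IsFractalModel [MeasurableSpace (SmallSet d)] (μ : Measure (SmallSet d)) : Prop where
  translation_invariant : ∀ (x : Space d) (D : Set (SmallSet d)), MeasurableSet D →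
    μ (translateFamily x D) = μ D
  scale_invariant : ∀ (s : ℝ) (D : Set (SmallSet d)), 0 < s → MeasurableSet D → μ D < ∞ →
    StaysSmall s D → μ (dilateFamily s D) = μ D
  locally_finite : ∀ (A : Set (Space d)) (δ : ℝ), Bornology.IsBounded A → 0 < δ →
    μ {G | G ∈ hitting A ∧ δ ≤ G.diam} < ∞
  frontier_null : μ {G | 0 < volume (frontier G.carrier)} = 0
  volume_pos : 0 < μ {G | 0 < volume G.carrier}

/-- The random subset `Φ` of `X` is a Poisson process with intensity measure `ν`. -/
structure IsPoissonProcess {Ω X : Type*} [MeasurableSpace Ω] [MeasurableSpace X]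
    (Φ : Ω → Set X) (ν : Measure X) (P : Measure Ω) : Prop where
  measurable_count : ∀ D : Set X, MeasurableSet D → Measurable fun ω => (Φ ω ∩ D).encard
  law_count : ∀ D : Set X, MeasurableSet D → ν D < ∞ →
    P.map (fun ω => (Φ ω ∩ D).encard)
      = (poissonMeasure (ν D).toNNReal).map (fun k : ℕ => (k : ℕ∞))
  count_top : ∀ D : Set X, MeasurableSet D → ν D = ∞ → ∀ᵐ ω ∂P, (Φ ω ∩ D).encard = ⊤
  independent : ∀ (n : ℕ) (D : Fin n → Set X), (∀ i, MeasurableSet (D i)) →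
    Pairwise (fun i j => Disjoint (D i) (D j)) →
    iIndepFun (fun (i : Fin n) ω => (Φ ω ∩ D i).encard) P

/-- The closed box with lower corner `2^{-n} k` and side length `2^{-n}`. -/
noncomputable def box (n : ℕ) (k : Fin d → ℕ) : Set (Space d) :=
  {y | ∀ i, (k i : ℝ) * (2 : ℝ) ^ (-(n : ℤ)) ≤ y i ∧ y i ≤ ((k i : ℝ) + 1) * (2 : ℝ) ^ (-(n : ℤ))}

/-- `ℬ_n`: the `2^{dn}` level `n` boxes, which tile `[0,1]^d`. -/
def levelBoxes (d n : ℕ) : Set (Set (Space d)) :=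
  {B | ∃ k : Fin d → ℕ, (∀ i, k i < 2 ^ n) ∧ B = box n k}

/-- `m_n`: the level `n` boxes that are met by no set of the collection `φ` that has diameter at
least `2^{-n}`. -/
def untouched (φ : Set (SmallSet d)) (n : ℕ) : Set (Set (Space d)) :=
  {B | B ∈ levelBoxes d n ∧ ¬ ∃ G ∈ φ, G ∈ atLeast d n ∧ (B ∩ G.carrier).Nonempty}

/-- The number of children of the box `B` in the set `S` of boxes of the next generation. -/
noncomputable def childCount (S : Finset (Set (Space d))) (B : Set (Space d)) : ℕ :=
  {B' | B' ∈ S ∧ B' ⊆ B}.ncard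

/-- The family tree of a Galton–Watson branching process with offspring distribution `p`, embedded
in the untouched boxes. The ancestor is `[0,1]^d`, the individuals of generation `l` are the boxes
in `W l`; these are untouched boxes of level `l N`, each contained in its parent. Given the first
`l` generations, the numbers of children of the individuals of generation `l` are independent with
law `p`. (The generations take values in finite sets, so elementary conditioning suffices.) -/
structure IsEmbeddedGaltonWatson {Ω : Type*} [MeasurableSpace Ω] (P : Measure Ω)
    (Φ : Ω → Set (SmallSet d)) (N : ℕ) (p : PMF ℕ) (W : ℕ → Ω → Finset (Set (Space d))) :
    Prop where
  root : ∀ ω, W 0 ω = {box 0 (fun _ => 0)}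
  untouched_mem : ∀ l ω, ∀ B ∈ W l ω, B ∈ untouched (Φ ω) (l * N)
  parent : ∀ l ω, ∀ B ∈ W (l + 1) ω, ∃ B' ∈ W l ω, B ⊆ B'
  measurable_generation : ∀ l (w : Finset (Set (Space d))), MeasurableSet {ω | W l ω = w}
  branching : ∀ (l : ℕ) (w : ℕ → Finset (Set (Space d))) (k : Set (Space d) → ℕ),
    P {ω | (∀ j ≤ l, W j ω = w j) ∧ ∀ B ∈ w l, childCount (W (l + 1) ω) B = k B}
      = P {ω | ∀ j ≤ l, W j ω = w j} * ∏ B ∈ w l, p (k B)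

/-- Along `ω` the embedded tree, with one generation every `N` levels, survives and has growth rate
`g` per level: `|T_n|^{1/n} → g` along the levels `n = l N`. -/
def SurvivesWithGrowthRate {Ω : Type*} (N : ℕ) (W : ℕ → Ω → Finset (Set (Space d))) (g : ℝ)
    (ω : Ω) : Prop :=
  (∀ l, (W l ω).Nonempty) ∧
    Tendsto (fun l : ℕ => ((W l ω).card : ℝ) ^ (1 / ((l * N : ℕ) : ℝ))) atTop (𝓝 g)

end PoissonFractal

open PoissonFractal

namespace PoissonFractal

variable {d : ℕ}

/-! Fix `M` and let one generation span `N = M + 1` levels. A box of generation `l` is given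
`2^(M*d)` potential children, those with even offsets, and a child survives if it is met by no set
of `Φ` with diameter between the side of the child and the side of its parent. Larger sets meeting
the child also meet the parent, so by induction the survivors are untouched (`box_mem_untouched`).

Even offsets separate distinct boxes of one generation by at least their side, so no set of smaller
diameter meets two of them (`disjoint_parentShell`). The offspring numbers of a generation therefore
depend on `Φ` in disjoint regions of `𝔊`, which are also disjoint from the region that decides the
past. Void probabilities are exponentials of the intensity, whence independence
(`IsPoissonProcess.iIndep_voidSigma`). Translation and scale invariance make all offspring laws
equal (`measure_freeChildren_preimage`). This is the Galton–Watson property.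

The mean number of children is `2^(M*d)` times the exponential of `-λ` times a sum of `M + 1` terms,
each being the mass of the sets with diameter in `[1/2, 1)` that meet a small box at the origin
(`meanOffspring_eq`). As these boxes shrink to the origin the terms converge to `μ(𝒜₁)`: a set
meeting all of them without containing the origin has the origin on its boundary, which is null by
Fubini and translation invariance. By Cesàro, the logarithm of the mean per level tends to `d log 2
- λ μ(𝒜₁)`, so a large `M` gives the required `g > 1`.

For the growth, let `Z l` be the generation sizes and `m` the mean. The increments of `Z l / m^l`
are centred, and a variance computation makes them absolutely summable in mean. The limit has mean
one, so it is positive with positive probability (`measure_growth_pos`); a positive limit yields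
both survival and the growth rate. -/

/-- The side length `2^{-n}` of the level `n` boxes. -/
noncomputable def side (n : ℕ) : ℝ := (2 : ℝ) ^ (-(n : ℤ))

lemma side_pos (n : ℕ) : 0 < side n := by unfold side; positivity

lemma side_zero : side 0 = 1 := by simp [side]

lemma side_add (m n : ℕ) : side (m + n) = side m * side n := by
  simp only [side, Nat.cast_add, neg_add]
  rw [zpow_add₀ two_ne_zero]

lemma side_succ (n : ℕ) : side (n + 1) = side n / 2 := by
  rw [side_add]; simp [side]; ring

lemma side_mul_two_pow (n : ℕ) : side n * 2 ^ n = 1 := by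
  simp [side]

lemma side_anti : Antitone side :=
  antitone_nat_of_succ_le fun n => by rw [side_succ]; linarith [side_pos n]

lemma side_le_one (n : ℕ) : side n ≤ 1 := side_zero ▸ side_anti (Nat.zero_le n)

lemma tendsto_side : Tendsto side atTop (𝓝 0) := by
  have : side = fun n => (1 / 2 : ℝ) ^ n := by
    funext n; simp [side]
  rw [this]
  exact tendsto_pow_atTop_nhds_zero_of_lt_one (by norm_num) (by norm_num)

lemma mem_box {n : ℕ} {k : Fin d → ℕ} {y : Space d} :
    y ∈ box n k ↔ ∀ i, k i * side n ≤ y i ∧ y i ≤ (k i + 1) * side n := Iff.rfl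

/-- The sets of `𝔊` that meet `A` and have diameter in `[a, b)`. -/
def shell (a b : ℝ) (A : Set (Space d)) : Set (SmallSet d) :=
  {G | G ∈ hitting A ∧ a ≤ G.diam ∧ G.diam < b}

lemma SmallSet.dist_le_diam (G : SmallSet d) {x y : Space d} (hx : x ∈ G.carrier)
    (hy : y ∈ G.carrier) : dist x y ≤ G.diam :=
  Metric.dist_le_diam_of_mem G.bounded hx hy

lemma SmallSet.exists_dist_gt (G : SmallSet d) {r : ℝ} (hr : 0 ≤ r) (h : r < G.diam) :
    ∃ x ∈ G.carrier, ∃ y ∈ G.carrier, r < dist x y := by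
  by_contra! hc
  exact absurd (Metric.diam_le_of_forall_dist_le hr hc) (not_le.2 h)

lemma isCompact_box (n : ℕ) (k : Fin d → ℕ) : IsCompact (box n k) := by
  have : box n k = (EuclideanSpace.equiv (Fin d) ℝ).toHomeomorph ⁻¹'
      (Set.univ.pi fun i => Set.Icc ((k i : ℝ) * side n) ((k i + 1) * side n)) := by
    ext y
    simp only [mem_box, Set.mem_preimage, Set.mem_univ_pi, Set.mem_Icc]
    rfl
  rw [this, Homeomorph.isCompact_preimage]
  exact isCompact_univ_pi fun i => isCompact_Icc

lemma isBounded_box (n : ℕ) (k : Fin d → ℕ) : Bornology.IsBounded (box n k) :=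
  (isCompact_box n k).isBounded

/-! ### Measurability of the diameter and of closure, interior and frontier -/

section Measurability

variable [MeasurableSpace (SmallSet d)] [SuitableSigmaAlgebra d]

lemma measurableSet_hitting {K : Set (Space d)} (hK : IsCompact K) : MeasurableSet (hitting K) :=
  SuitableSigmaAlgebra.hitting_mem K hK

lemma measurableSet_covering {K : Set (Space d)} (hK : IsCompact K) :
    MeasurableSet (covering K) :=
  SuitableSigmaAlgebra.covering_mem K hK

/-- The diameter exceeds `r ≥ 0` exactly when the set meets two balls of a countable family of
compact balls, all of whose mutual distances exceed `r`. -/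
lemma measurable_diam : Measurable (SmallSet.diam (d := d)) := by
  refine measurable_of_Ioi fun r => ?_
  rcases lt_or_ge r 0 with hr | hr
  · have : SmallSet.diam (d := d) ⁻¹' Set.Ioi r = Set.univ :=
      Set.eq_univ_of_forall fun G => hr.trans_le Metric.diam_nonneg
    rw [this]; exact MeasurableSet.univ
  let q : ℕ → Space d := TopologicalSpace.denseSeq (Space d)
  let K : ℕ → ℕ → Set (Space d) := fun m k => Metric.closedBall (q m) (1 / ((k : ℝ) + 1))
  have key : SmallSet.diam (d := d) ⁻¹' Set.Ioi r = ⋃ (m : ℕ) (n : ℕ) (k : ℕ)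
      (_ : ∀ x ∈ K m k, ∀ y ∈ K n k, r < dist x y), hitting (K m k) ∩ hitting (K n k) := by
    ext G
    simp only [Set.mem_preimage, Set.mem_Ioi, Set.mem_iUnion, Set.mem_inter_iff]
    constructor
    · intro h
      obtain ⟨x, hx, y, hy, hxy⟩ := G.exists_dist_gt hr h
      -- Replacing `x` and `y` by other points of their balls costs two radii each, hence the factor
      -- four.
      obtain ⟨k, hk⟩ := exists_nat_one_div_lt (show 0 < (dist x y - r) / 4 by linarith)
      have hk0 : (0 : ℝ) < 1 / ((k : ℝ) + 1) := by positivity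
      obtain ⟨m, hm⟩ := (TopologicalSpace.denseRange_denseSeq (Space d)).exists_dist_lt x hk0
      obtain ⟨n, hn⟩ := (TopologicalSpace.denseRange_denseSeq (Space d)).exists_dist_lt y hk0
      refine ⟨m, n, k, ?_, ⟨x, hx, hm.le⟩, ⟨y, hy, hn.le⟩⟩
      intro u hu v hv
      have h1 : dist u (q m) ≤ 1 / ((k : ℝ) + 1) := hu
      have h2 : dist v (q n) ≤ 1 / ((k : ℝ) + 1) := hv
      have h3 : dist x (q m) < 1 / ((k : ℝ) + 1) := hm
      have h4 : dist y (q n) < 1 / ((k : ℝ) + 1) := hn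
      have h5 := dist_triangle4 x u v y
      have h6 := dist_triangle_right x u (q m)
      have h7 := dist_triangle_right v y (q n)
      linarith
    · rintro ⟨m, n, k, hK, ⟨x, hx, hxm⟩, ⟨y, hy, hyn⟩⟩
      exact (hK x hxm y hyn).trans_le (G.dist_le_diam hx hy)
  rw [key]
  exact MeasurableSet.iUnion fun m => MeasurableSet.iUnion fun n => MeasurableSet.iUnion fun k =>
    MeasurableSet.iUnion fun _ => (measurableSet_hitting (isCompact_closedBall _ _)).inter
      (measurableSet_hitting (isCompact_closedBall _ _))

lemma measurableSet_shell {a b : ℝ} {A : Set (Space d)} (hA : IsCompact A) :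
    MeasurableSet (shell a b A) :=
  (measurableSet_hitting hA).inter
    ((measurable_diam measurableSet_Ici).inter (measurable_diam measurableSet_Iio))

/-- Joint measurability in the point and the set is what the Fubini argument for boundaries
requires. Closure points are detected by hitting events of arbitrarily small balls around them,
interior points below by covering events. -/
lemma measurableSet_mem_closure :
    MeasurableSet {z : Space d × SmallSet d | z.1 ∈ closure z.2.carrier} := by
  let q : ℕ → Space d := TopologicalSpace.denseSeq (Space d)
  let K : ℕ → ℕ → Set (Space d) := fun m k => Metric.closedBall (q m) (1 / ((k : ℝ) + 1))
  have key : {z : Space d × SmallSet d | z.1 ∈ closure z.2.carrier} =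
      ⋂ k : ℕ, ⋃ m : ℕ, K m k ×ˢ hitting (K m k) := by
    ext ⟨x, G⟩
    simp only [Set.mem_ofPred_eq, Set.mem_iInter, Set.mem_iUnion, Set.mem_prod]
    constructor
    · intro h k
      have hk0 : (0 : ℝ) < 1 / ((k : ℝ) + 1) / 2 := by positivity
      obtain ⟨y, hy, hxy⟩ := Metric.mem_closure_iff.1 h _ hk0
      obtain ⟨m, hm⟩ := (TopologicalSpace.denseRange_denseSeq (Space d)).exists_dist_lt x hk0
      have h3 : dist x (q m) < 1 / ((k : ℝ) + 1) / 2 := hm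
      refine ⟨m, Metric.mem_closedBall.2 (by linarith), y, hy, Metric.mem_closedBall.2 ?_⟩
      linarith [dist_triangle_left y (q m) x]
    · intro h
      refine Metric.mem_closure_iff.2 fun ε hε => ?_
      obtain ⟨k, hk⟩ := exists_nat_one_div_lt (show 0 < ε / 2 by linarith)
      obtain ⟨m, hm, y, hy, hym⟩ := h k
      refine ⟨y, hy, ?_⟩
      have h1 : dist x (q m) ≤ 1 / ((k : ℝ) + 1) := hm
      have h2 : dist y (q m) ≤ 1 / ((k : ℝ) + 1) := hym
      linarith [dist_triangle_right x y (q m)]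
  rw [key]
  exact MeasurableSet.iInter fun k => MeasurableSet.iUnion fun m =>
    Metric.isClosed_closedBall.measurableSet.prod
      (measurableSet_hitting (isCompact_closedBall _ _))

lemma measurableSet_mem_interior :
    MeasurableSet {z : Space d × SmallSet d | z.1 ∈ interior z.2.carrier} := by
  let q : ℕ → Space d := TopologicalSpace.denseSeq (Space d)
  let r : ℕ → ℝ := fun k => 1 / ((k : ℝ) + 1)
  have key : {z : Space d × SmallSet d | z.1 ∈ interior z.2.carrier} =
      ⋃ (k : ℕ) (m : ℕ), Metric.ball (q m) (r k) ×ˢ covering (Metric.closedBall (q m) (r k)) := by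
    ext ⟨x, G⟩
    simp only [Set.mem_ofPred_eq, Set.mem_iUnion, Set.mem_prod]
    constructor
    · intro h
      obtain ⟨ε, hε, hs⟩ := Metric.isOpen_iff.1 isOpen_interior x h
      obtain ⟨k, hk⟩ := exists_nat_one_div_lt (show 0 < ε / 2 by linarith)
      have hk0 : (0 : ℝ) < 1 / ((k : ℝ) + 1) := by positivity
      obtain ⟨m, hm⟩ := (TopologicalSpace.denseRange_denseSeq (Space d)).exists_dist_lt x hk0
      have h3 : dist x (q m) < 1 / ((k : ℝ) + 1) := hm
      refine ⟨k, m, hm, fun y hy => interior_subset (hs ?_)⟩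
      have h2 : dist y (q m) ≤ 1 / ((k : ℝ) + 1) := hy
      exact Metric.mem_ball.2 (by linarith [dist_triangle_right y x (q m)])
    · rintro ⟨k, m, hx, hG⟩
      exact interior_mono hG (Metric.ball_subset_interior_closedBall hx)
  rw [key]
  exact MeasurableSet.iUnion fun k => MeasurableSet.iUnion fun m =>
    Metric.isOpen_ball.measurableSet.prod
      (measurableSet_covering (isCompact_closedBall _ _))

lemma measurableSet_mem_frontier :
    MeasurableSet {z : Space d × SmallSet d | z.1 ∈ frontier z.2.carrier} :=
  measurableSet_mem_closure.diff measurableSet_mem_interior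

end Measurability

/-! ### Shells and boxes under translation, dilation and inclusion -/

section Geometry

lemma diam_smul_image (s : ℝ) (hs : 0 ≤ s) (A : Set (Space d)) :
    Metric.diam ((fun y => s • y) '' A) = s * Metric.diam A := by
  have h := diam_smul₀ s A
  rw [Real.norm_of_nonneg hs] at h
  exact h

lemma diam_add_image (x : Space d) (A : Set (Space d)) :
    Metric.diam ((fun y => x + y) '' A) = Metric.diam A :=
  (isometry_add_left x).diam_image A

lemma isBounded_smul_image (s : ℝ) {A : Set (Space d)} (hA : Bornology.IsBounded A) :
    Bornology.IsBounded ((fun y => s • y) '' A) := hA.smul₀ s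

lemma isBounded_add_image (x : Space d) {A : Set (Space d)} (hA : Bornology.IsBounded A) :
    Bornology.IsBounded ((fun y => x + y) '' A) :=
  (isometry_add_left x).lipschitz.isBounded_image hA

lemma translateFamily_shell (x : Space d) (a b : ℝ) (A : Set (Space d)) :
    translateFamily x (shell a b A) = shell a b ((fun y => x + y) '' A) := by
  ext L
  constructor
  · rintro ⟨G, ⟨⟨y, hy, hyA⟩, h1, h2⟩, hL⟩
    have hd : L.diam = G.diam := by simp only [SmallSet.diam, hL, diam_add_image]
    exact ⟨⟨x + y, hL ▸ ⟨y, hy, rfl⟩, ⟨y, hyA, rfl⟩⟩, hd ▸ h1, hd ▸ h2⟩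
  · rintro ⟨⟨z, hz, ⟨y, hyA, rfl⟩⟩, h1, h2⟩
    have hd := diam_add_image (-x) L.carrier
    refine ⟨⟨(fun y => -x + y) '' L.carrier, isBounded_add_image _ L.bounded,
      hd ▸ L.diam_lt_one⟩, ⟨⟨y, ⟨x + y, hz, by simp⟩, hyA⟩, h1.trans_eq hd.symm,
        hd.trans_lt h2⟩, ?_⟩
    simp only [Set.image_image, add_neg_cancel_left, Set.image_id']

/-- The bound `b ≤ 1` ensures that the set obtained by scaling back by `s⁻¹` still belongs to `𝔊`,
so that the dilated shell is exhausted. -/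
lemma dilateFamily_shell {s : ℝ} (hs : 0 < s) {a b : ℝ} (hb : b ≤ 1) (A : Set (Space d)) :
    dilateFamily s (shell a b A) = shell (s * a) (s * b) ((fun y => s • y) '' A) := by
  ext L
  constructor
  · rintro ⟨G, ⟨⟨y, hy, hyA⟩, h1, h2⟩, hL⟩
    have hd : L.diam = s * G.diam := by
      simp only [SmallSet.diam, hL, diam_smul_image s hs.le]
    exact ⟨⟨s • y, hL ▸ ⟨y, hy, rfl⟩, ⟨y, hyA, rfl⟩⟩, hd ▸ by gcongr, hd ▸ by gcongr⟩
  · rintro ⟨⟨z, hz, ⟨y, hyA, rfl⟩⟩, h1, h2⟩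
    have hd : Metric.diam ((fun y => s⁻¹ • y) '' L.carrier) = s⁻¹ * L.diam :=
      diam_smul_image _ (by positivity) L.carrier
    have hlt : s⁻¹ * L.diam < b := by rwa [inv_mul_lt_iff₀ hs]
    refine ⟨⟨(fun y => s⁻¹ • y) '' L.carrier, isBounded_smul_image _ L.bounded,
      by rw [hd]; exact hlt.trans_le hb⟩,
      ⟨⟨y, ⟨s • y, hz, by simp [smul_smul, hs.ne']⟩, hyA⟩, ?_, ?_⟩, ?_⟩
    · change a ≤ Metric.diam _
      rw [hd, le_inv_mul_iff₀ hs]; exact h1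
    · change Metric.diam _ < b
      rw [hd]; exact hlt
    · simp [Set.image_image, smul_smul, hs.ne']

lemma staysSmall_shell {s : ℝ} (hs : 0 < s) {a b : ℝ} (hsb : s * b ≤ 1) (A : Set (Space d)) :
    StaysSmall s (shell a b A) := by
  rintro G ⟨-, -, h2⟩
  rw [diam_smul_image s hs.le]
  calc s * G.diam < s * b := by gcongr
    _ ≤ 1 := hsb

lemma translateFamily_iUnion {ι : Sort*} (x : Space d) (D : ι → Set (SmallSet d)) :
    translateFamily x (⋃ i, D i) = ⋃ i, translateFamily x (D i) := by
  ext L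
  simp only [translateFamily, Set.mem_iUnion, Set.mem_ofPred_eq]
  tauto

lemma dilateFamily_iUnion {ι : Sort*} (s : ℝ) (D : ι → Set (SmallSet d)) :
    dilateFamily s (⋃ i, D i) = ⋃ i, dilateFamily s (D i) := by
  ext L
  simp only [dilateFamily, Set.mem_iUnion, Set.mem_ofPred_eq]
  tauto

/-- The lower corner of the box with index `k` at level `n`. -/
noncomputable def corner (n : ℕ) (k : Fin d → ℕ) : Space d :=
  WithLp.toLp 2 fun i => (k i : ℝ) * side n

lemma smul_image_box (m n : ℕ) (k : Fin d → ℕ) :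
    (fun y : Space d => side m • y) '' box n k = box (m + n) k := by
  ext z
  have hm := side_pos m
  constructor
  · rintro ⟨y, hy, rfl⟩ i
    have := hy i
    change (k i : ℝ) * side (m + n) ≤ side m * y i ∧ side m * y i ≤ (k i + 1) * side (m + n)
    rw [side_add, mul_left_comm, mul_left_comm _ (side m)]
    exact ⟨mul_le_mul_of_nonneg_left this.1 hm.le, mul_le_mul_of_nonneg_left this.2 hm.le⟩
  · intro hz
    refine ⟨(side m)⁻¹ • z, fun i => ?_, by simp [smul_smul, hm.ne']⟩
    have := mem_box.1 hz i
    rw [side_add, mul_left_comm, mul_left_comm _ (side m)] at this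
    change (k i : ℝ) * side n ≤ (side m)⁻¹ * z i ∧ (side m)⁻¹ * z i ≤ (k i + 1) * side n
    rwa [le_inv_mul_iff₀ hm, inv_mul_le_iff₀ hm]

lemma add_image_box (m r : ℕ) (j k : Fin d → ℕ) :
    (fun y : Space d => corner m j + y) '' box (m + r) k
      = box (m + r) fun i => 2 ^ r * j i + k i := by
  have h2 : ∀ i, (j i : ℝ) * side m = 2 ^ r * j i * side (m + r) := fun i => by
    rw [side_add]
    linear_combination (-(j i : ℝ) * side m) * side_mul_two_pow r
  ext z
  constructor
  · rintro ⟨y, hy, rfl⟩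
    refine mem_box.2 fun i => ?_
    have := mem_box.1 hy i
    have h3 : (corner m j + y) i = (j i : ℝ) * side m + y i := rfl
    rw [h3, h2]
    push_cast
    constructor <;> nlinarith [this.1, this.2]
  · intro hz
    refine ⟨-corner m j + z, mem_box.2 fun i => ?_, by simp⟩
    have := mem_box.1 hz i
    have h3 : (-corner m j + z) i = -((j i : ℝ) * side m) + z i := rfl
    rw [h3, h2]
    push_cast at this
    constructor <;> nlinarith [this.1, this.2]

/-- A set that meets two boxes of the same level whose indices differ by at least two has diameter
at least the side length. -/
lemma SmallSet.side_le_diam (G : SmallSet d) {n : ℕ} {j k : Fin d → ℕ} {i : Fin d}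
    (hjk : j i + 2 ≤ k i) (hj : G ∈ hitting (box n j)) (hk : G ∈ hitting (box n k)) :
    side n ≤ G.diam := by
  obtain ⟨x, hx, hxj⟩ := hj
  obtain ⟨y, hy, hyk⟩ := hk
  have h1 := (mem_box.1 hxj i).2
  have h2 := (mem_box.1 hyk i).1
  have h3 : ((j i : ℝ) + 2) ≤ k i := by exact_mod_cast hjk
  have h4 : dist (y i) (x i) ≤ dist y x := by
    rw [EuclideanSpace.dist_eq, ← Real.sqrt_sq (dist_nonneg (x := y i) (y := x i))]
    exact Real.sqrt_le_sqrt
      (Finset.single_le_sum (f := fun i => dist (y i) (x i) ^ 2) (fun _ _ => sq_nonneg _)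
        (Finset.mem_univ i))
  have h5 := (le_abs_self (y i - x i)).trans h4
  have h6 := G.dist_le_diam hy hx
  have := side_pos n
  nlinarith

/-- A box determines its ancestors through its index. -/
lemma box_subset_box_iff {m r : ℕ} {j k : Fin d → ℕ} :
    box (m + r) k ⊆ box m j ↔ ∀ i, k i / 2 ^ r = j i := by
  have hr := side_pos r
  have hm := side_pos m
  have hr2 := side_mul_two_pow r
  constructor
  · intro h i
    -- The centre of the small box is tested: unlike a corner it lies off the faces of the large
    -- boxes, and the slack `1/2` turns weak real inequalities into the sharp integer ones.
    let y : Space d := WithLp.toLp 2 fun i => ((k i : ℝ) + 1 / 2) * side (m + r)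
    have hy : y ∈ box (m + r) k := mem_box.2 fun i => by
      change (k i : ℝ) * side (m + r) ≤ ((k i : ℝ) + 1 / 2) * side (m + r) ∧
        ((k i : ℝ) + 1 / 2) * side (m + r) ≤ (k i + 1) * side (m + r)
      have := side_pos (m + r)
      constructor <;> nlinarith
    have h1 := mem_box.1 (h hy) i
    have h2 : y i = ((k i : ℝ) + 1 / 2) * side (m + r) := rfl
    rw [h2, side_add, mul_left_comm, mul_comm _ (side m), mul_comm _ (side m)] at h1
    have h3 := le_of_mul_le_mul_left h1.1 hm
    have h4 := le_of_mul_le_mul_left h1.2 hm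
    have h5 : (j i : ℝ) * 2 ^ r ≤ k i + 1 / 2 := by nlinarith [pow_pos (two_pos : (0:ℝ) < 2) r]
    have h6 : (k i : ℝ) + 1 / 2 ≤ (j i + 1) * 2 ^ r := by
      nlinarith [pow_pos (two_pos : (0:ℝ) < 2) r]
    have h7 : (j i * 2 ^ r : ℕ) < k i + 1 := by
      have : ((j i * 2 ^ r : ℕ) : ℝ) < (k i + 1 : ℕ) := by push_cast; linarith
      exact_mod_cast this
    have h8 : k i < (j i + 1) * 2 ^ r := by
      have : (k i : ℝ) < ((j i + 1) * 2 ^ r : ℕ) := by push_cast; linarith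
      exact_mod_cast this
    exact Nat.div_eq_of_lt_le (by omega) h8
  · intro h y hy
    refine mem_box.2 fun i => ?_
    have h1 := mem_box.1 hy i
    have hp : 0 < 2 ^ r := by positivity
    have h2 : j i * 2 ^ r ≤ k i := by rw [← h i]; exact Nat.div_mul_le_self _ _
    have h3 : k i + 1 ≤ (j i + 1) * 2 ^ r := by
      rw [← h i]; exact Nat.lt_mul_of_div_lt (Nat.lt_succ_self _) hp
    have h2' : (j i : ℝ) * 2 ^ r ≤ k i := by exact_mod_cast h2
    have h3' : (k i : ℝ) + 1 ≤ (j i + 1) * 2 ^ r := by exact_mod_cast h3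
    have e : ∀ t : ℝ, t * side m = t * 2 ^ r * side (m + r) := fun t => by
      rw [side_add]; linear_combination (-t * side m) * hr2
    have hs := side_pos (m + r)
    rw [e, e]
    exact ⟨(mul_le_mul_of_nonneg_right h2' hs.le).trans h1.1,
      h1.2.trans (mul_le_mul_of_nonneg_right h3' hs.le)⟩

lemma box_injective (n : ℕ) : Function.Injective (box (d := d) n) := by
  intro j k h
  funext i
  have := (box_subset_box_iff (m := n) (r := 0)).1 h.le i
  simpa using this

lemma shell_union_shell {a b c : ℝ} (hab : a ≤ b) (hbc : b ≤ c) (A : Set (Space d)) :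
    shell a b A ∪ shell b c A = shell a c A := by
  ext G
  constructor
  · rintro (⟨h, h1, h2⟩ | ⟨h, h1, h2⟩)
    · exact ⟨h, h1, h2.trans_le hbc⟩
    · exact ⟨h, hab.trans h1, h2⟩
  · rintro ⟨h, h1, h2⟩
    rcases lt_or_ge G.diam b with h3 | h3
    · exact Or.inl ⟨h, h1, h3⟩
    · exact Or.inr ⟨h, h3, h2⟩

lemma zero_mem_box (n : ℕ) : (0 : Space d) ∈ box n 0 := mem_box.2 fun i => by
  simpa using (side_pos n).le

lemma norm_le_of_mem_box {n : ℕ} {y : Space d} (hy : y ∈ box n 0) : ‖y‖ ≤ d * side n := by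
  have hs := (side_pos n).le
  rw [EuclideanSpace.norm_eq]
  refine Real.sqrt_le_iff.2 ⟨by positivity, ?_⟩
  calc ∑ i, ‖y i‖ ^ 2 ≤ ∑ _i : Fin d, side n ^ 2 := by
        refine Finset.sum_le_sum fun i _ => ?_
        have := mem_box.1 hy i
        simp only [Pi.zero_apply, Nat.cast_zero, zero_mul, zero_add, one_mul] at this
        rw [Real.norm_of_nonneg this.1]
        exact pow_le_pow_left₀ this.1 this.2 2
    _ = d * side n ^ 2 := by simp
    _ ≤ (d * side n) ^ 2 := by
        rw [mul_pow]
        gcongr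
        exact_mod_cast Nat.le_self_pow two_ne_zero d

lemma box_zero_anti : Antitone fun n => box n (0 : Fin d → ℕ) := by
  intro m n hmn y hy
  refine mem_box.2 fun i => ?_
  have := mem_box.1 hy i
  simp only [Pi.zero_apply, Nat.cast_zero, zero_mul, zero_add, one_mul] at this ⊢
  exact ⟨this.1, this.2.trans (side_anti hmn)⟩

end Geometry

/-! ### Intensities of shells and their limit -/

section Intensity

lemma IsFractalModel.measure_shell_lt_top [MeasurableSpace (SmallSet d)]
    {μ : Measure (SmallSet d)} (hμ : IsFractalModel μ) {a : ℝ} (ha : 0 < a) (b : ℝ)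
    {A : Set (Space d)} (hA : Bornology.IsBounded A) : μ (shell a b A) < ∞ :=
  (measure_mono (t := {G | G ∈ hitting A ∧ a ≤ G.diam}) fun _ hG => ⟨hG.1, hG.2.1⟩).trans_lt
    (hμ.locally_finite A a hA ha)

variable [MeasurableSpace (SmallSet d)] [SuitableSigmaAlgebra d] {μ : Measure (SmallSet d)}

lemma IsFractalModel.measure_translate_shell (hμ : IsFractalModel μ) {a b : ℝ} {A : Set (Space d)}
    (hA : IsCompact A) (x : Space d) :
    μ (shell a b ((fun y => x + y) '' A)) = μ (shell a b A) := by
  rw [← translateFamily_shell, hμ.translation_invariant x _ (measurableSet_shell hA)]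

/-- Dilation by `side m` followed by translation by `corner m j` carries one union onto the other.
Finite unions are treated because their intensities determine the joint law of the void indicators.
-/
lemma IsFractalModel.measure_biUnion_shell_box (hμ : IsFractalModel μ) {a b : ℝ} (ha : 0 < a)
    (hb : b ≤ 1) (m r : ℕ) (j : Fin d → ℕ) {ι : Type*} (S : Finset ι) (k : ι → Fin d → ℕ) :
    μ (⋃ i ∈ S, shell (side m * a) (side m * b) (box (m + r) fun t => 2 ^ r * j t + k i t))
      = μ (⋃ i ∈ S, shell a b (box r (k i))) := by
  have hm := side_pos m
  have hmeas : MeasurableSet (⋃ i ∈ S, shell a b (box r (k i))) :=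
    S.measurableSet_biUnion fun i _ => measurableSet_shell (isCompact_box _ _)
  have hfin : μ (⋃ i ∈ S, shell a b (box r (k i))) < ∞ :=
    (measure_biUnion_lt_top S.finite_toSet fun i _ =>
      hμ.measure_shell_lt_top ha b (isBounded_box _ _))
  have hsmall : StaysSmall (side m) (⋃ i ∈ S, shell a b (box r (k i))) := by
    intro G hG
    simp only [Set.mem_iUnion] at hG
    obtain ⟨i, -, hi⟩ := hG
    refine staysSmall_shell hm (b := b) ?_ _ G hi
    nlinarith [side_le_one m]
  rw [← hμ.scale_invariant (side m) _ hm hmeas hfin hsmall,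
    ← hμ.translation_invariant (corner m j) _
      (SuitableSigmaAlgebra.dilate_mem _ _ hm hmeas hsmall)]
  congr 1
  simp only [dilateFamily_iUnion, translateFamily_iUnion, dilateFamily_shell hm hb,
    translateFamily_shell, smul_image_box, add_image_box]

lemma IsFractalModel.measure_shell_box_zero (hμ : IsFractalModel μ) {a b : ℝ} (n : ℕ)
    (k : Fin d → ℕ) :
    μ (shell a b (box n k)) = μ (shell a b (box n 0)) := by
  rw [← hμ.measure_translate_shell (isCompact_box n 0) (corner n k)]
  congr 2
  simpa using (add_image_box n 0 k 0).symm

lemma IsFractalModel.measure_shell_side (hμ : IsFractalModel μ) (m r : ℕ) :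
    μ (shell (side (m + 1)) (side m) (box (m + r) 0)) = μ (shell (1 / 2) 1 (box r 0)) := by
  have := hμ.measure_biUnion_shell_box (a := 1 / 2) (b := 1) (by norm_num) le_rfl m r 0
    {()} (fun _ => 0)
  simp only [Finset.set_biUnion_singleton, mul_one, Pi.zero_apply, mul_zero, add_zero] at this
  rw [side_succ, div_eq_mul_one_div]
  exact this

lemma measureReal_shell_eq_sum (hμ : IsFractalModel μ) {A : Set (Space d)} (hA : IsCompact A)
    (n : ℕ) :
    μ.real (shell (side n) 1 A)
      = ∑ l ∈ Finset.range n, μ.real (shell (side (l + 1)) (side l) A) := by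
  induction n with
  | zero =>
    have : shell (side 0) 1 A = ∅ := by
      ext G
      simp only [shell, side_zero, Set.mem_ofPred_eq, Set.mem_empty_iff_false, iff_false]
      rintro ⟨-, h1, h2⟩
      exact absurd h1 (not_le.2 h2)
    simp [this]
  | succ n ih =>
    rw [Finset.sum_range_succ, ← ih,
      ← shell_union_shell (side_anti n.le_succ) (side_le_one n) A,
      measureReal_union (Set.disjoint_left.2 fun G h1 h2 => absurd h2.2.1 (not_le.2 h1.2.2))
        (measurableSet_shell hA)
        (hμ.measure_shell_lt_top (side_pos _) _ hA.isBounded).ne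
        (hμ.measure_shell_lt_top (side_pos _) _ hA.isBounded).ne, add_comm]

/-- The diameters are split dyadically and each piece is rescaled to `[1/2, 1)`. This enlarges the
level `n` box to level `n - l`, so the sum appears in reverse order. -/
lemma IsFractalModel.measureReal_shell_box (hμ : IsFractalModel μ) (n : ℕ) (k : Fin d → ℕ) :
    μ.real (shell (side n) 1 (box n k))
      = ∑ l ∈ Finset.range n, μ.real (shell (1 / 2) 1 (box (l + 1) (0 : Fin d → ℕ))) := by
  have h0 : μ.real (shell (side n) 1 (box n k)) = μ.real (shell (side n) 1 (box n 0)) := by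
    simp only [measureReal_def, hμ.measure_shell_box_zero n k]
  rw [h0, measureReal_shell_eq_sum hμ (isCompact_box _ _),
    ← Finset.sum_range_reflect (fun l => μ.real (shell (1 / 2) 1 (box (l + 1) (0 : Fin d → ℕ))))]
  refine Finset.sum_congr rfl fun l hl => ?_
  have hl' := Finset.mem_range.1 hl
  have h1 : n = l + (n - 1 - l + 1) := by omega
  simp only [measureReal_def]
  congr 1
  rw [← hμ.measure_shell_side l (n - 1 - l + 1), ← h1]

/-- A fixed point almost surely does not lie on the boundary of a set of given size. -/
lemma IsFractalModel.measure_zero_mem_frontier (hμ : IsFractalModel μ) :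
    μ {G | (0 : Space d) ∈ frontier G.carrier ∧ 1 / 2 ≤ G.diam} = 0 := by
  -- Restriction to `T` makes the measure finite, as Fubini needs. Radius two suffices: a translate
  -- with `x` on its frontier has a point within distance one of `x`, and `x` lies in the unit ball.
  let T : Set (SmallSet d) := shell (1 / 2) 1 (Metric.closedBall 0 2)
  have hT : MeasurableSet T := measurableSet_shell (isCompact_closedBall _ _)
  have hTfin : μ T < ∞ := hμ.measure_shell_lt_top (by norm_num) _ Metric.isBounded_closedBall
  let μT := μ.restrict T
  have : IsFiniteMeasure μT := ⟨by simpa [μT] using hTfin⟩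
  let F : Set (Space d × SmallSet d) := {z | z.1 ∈ frontier z.2.carrier}
  have hF : MeasurableSet F := measurableSet_mem_frontier
  have h0 : (volume.prod μT) F = 0 := by
    rw [Measure.prod_apply_symm hF]
    have : ∀ᵐ G ∂μT, volume ((fun x => (x, G)) ⁻¹' F) = 0 := by
      refine ae_restrict_of_ae ?_
      have := hμ.frontier_null
      filter_upwards [measure_eq_zero_iff_ae_notMem.1 this] with G hG
      exact nonpos_iff_eq_zero.1 (not_lt.1 hG)
    rw [lintegral_congr_ae this]; simp
  have h1 := Measure.measure_ae_null_of_prod_null h0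
  have hpos : (volume : Measure (Space d)) (Metric.ball 0 1) ≠ 0 :=
    (Metric.measure_ball_pos _ _ one_pos).ne'
  -- Fubini gives the claim at almost every point; one good point is enough, since translation
  -- invariance moves it to the origin.
  obtain ⟨x, hx, hx0⟩ : ∃ x ∈ Metric.ball (0 : Space d) 1, μT (Prod.mk x ⁻¹' F) = 0 := by
    by_contra! hc
    refine hpos (measure_mono_null (fun x hx => ?_) (ae_iff.1 h1))
    exact hc x hx
  have hFx : MeasurableSet (Prod.mk x ⁻¹' F) := measurable_prodMk_left hF
  have hF0 : MeasurableSet (Prod.mk (0 : Space d) ⁻¹' F) := measurable_prodMk_left hF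
  have hsub : {G : SmallSet d | (0 : Space d) ∈ frontier G.carrier ∧ 1 / 2 ≤ G.diam} =
      (Prod.mk (0 : Space d) ⁻¹' F) ∩ SmallSet.diam ⁻¹' Set.Ici (1 / 2) := rfl
  rw [← hμ.translation_invariant x _ (hsub ▸ hF0.inter (measurable_diam measurableSet_Ici))]
  rw [Measure.restrict_apply hFx] at hx0
  refine measure_mono_null ?_ hx0
  rintro L ⟨G, ⟨hG1, hG2⟩, hL⟩
  have hfr : frontier L.carrier = (fun y => x + y) '' frontier G.carrier := by
    rw [hL]; exact ((Homeomorph.addLeft x).image_frontier G.carrier).symm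
  have hxL : x ∈ frontier L.carrier := hfr ▸ ⟨0, hG1, by simp⟩
  have hdiam : L.diam = G.diam := by simp only [SmallSet.diam, hL, diam_add_image]
  refine ⟨hxL, ?_, hdiam ▸ hG2, L.diam_lt_one⟩
  obtain ⟨y, hy, hxy⟩ := Metric.mem_closure_iff.1 (frontier_subset_closure hxL) 1 one_pos
  refine ⟨y, hy, Metric.mem_closedBall.2 ?_⟩
  have := Metric.mem_ball.1 hx
  linarith [dist_triangle_left y 0 x]

/-- The boxes decrease to the origin, so continuity from above applies. A set meeting all of them
has the origin in its closure, hence contains it or has it on its frontier, and the latter is null.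
-/
lemma IsFractalModel.tendsto_measureReal_shell (hμ : IsFractalModel μ) :
    Tendsto (fun n => μ.real (shell (1 / 2) 1 (box n (0 : Fin d → ℕ)))) atTop
      (𝓝 (μ.real (originShell d 1))) := by
  have hanti : Antitone fun n => shell (1 / 2) 1 (box n (0 : Fin d → ℕ)) := by
    rintro m n hmn G ⟨⟨y, hy, hyb⟩, h⟩
    exact ⟨⟨y, hy, box_zero_anti hmn hyb⟩, h⟩
  have hfin : ∀ n, μ (shell (1 / 2) 1 (box n (0 : Fin d → ℕ))) ≠ ∞ := fun n =>
    (hμ.measure_shell_lt_top (by norm_num) _ (isBounded_box _ _)).ne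
  have hlim := tendsto_measure_iInter_atTop (μ := μ)
    (fun n => (measurableSet_shell (isCompact_box n (0 : Fin d → ℕ))).nullMeasurableSet)
    hanti ⟨0, hfin 0⟩
  have hsub : originShell d 1 ⊆ ⋂ n, shell (1 / 2) 1 (box n (0 : Fin d → ℕ)) := by
    rintro G ⟨h0, h1, h2⟩
    refine Set.mem_iInter.2 fun n => ⟨⟨0, h0, zero_mem_box n⟩, ?_, G.diam_lt_one⟩
    norm_num at h1 ⊢
    exact h1
  have hsup : (⋂ n, shell (1 / 2) 1 (box n (0 : Fin d → ℕ))) ⊆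
      originShell d 1 ∪ {G | (0 : Space d) ∈ frontier G.carrier ∧ 1 / 2 ≤ G.diam} := by
    intro G hG
    have hG' := Set.mem_iInter.1 hG
    by_cases h0 : (0 : Space d) ∈ G.carrier
    · refine Or.inl ⟨h0, ?_, ?_⟩
      · have := (hG' 0).2.1
        norm_num at this ⊢
        exact this
      · have := G.diam_lt_one
        norm_num
        exact this
    · refine Or.inr ⟨⟨?_, fun h => h0 (interior_subset h)⟩, (hG' 0).2.1⟩
      refine Metric.mem_closure_iff.2 fun ε hε => ?_
      have ht : Tendsto (fun n => d * side n) atTop (𝓝 0) := by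
        simpa using tendsto_side.const_mul (d : ℝ)
      obtain ⟨n, hn⟩ := (ht.eventually (gt_mem_nhds hε)).exists
      obtain ⟨⟨y, hy, hyb⟩, -⟩ := hG' n
      exact ⟨y, hy, by rw [dist_zero_left]; exact (norm_le_of_mem_box hyb).trans_lt hn⟩
  have heq : μ (⋂ n, shell (1 / 2) 1 (box n (0 : Fin d → ℕ))) = μ (originShell d 1) := by
    refine le_antisymm ?_ (measure_mono hsub)
    refine (measure_mono hsup).trans ((measure_union_le _ _).trans ?_)
    rw [hμ.measure_zero_mem_frontier, add_zero]
  rw [heq] at hlim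
  exact (ENNReal.tendsto_toReal
    ((measure_mono (hsub.trans (Set.iInter_subset _ 0))).trans_lt (hfin 0).lt_top).ne).comp hlim

end Intensity

/-! ### Void events of a Poisson process: independence and laws -/

section Void

variable {Ω X : Type*}

/-- The event that no point of `Φ` lies in `D`. -/
def voidEvent (Φ : Ω → Set X) (D : Set X) : Set Ω := {ω | Φ ω ∩ D = ∅}

lemma biInter_voidEvent (Φ : Ω → Set X) {ι : Type*} (S : Finset ι) (D : ι → Set X) :
    ⋂ i ∈ S, voidEvent Φ (D i) = voidEvent Φ (⋃ i ∈ S, D i) := by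
  ext ω
  simp only [voidEvent, Set.mem_iInter, Set.mem_ofPred_eq, Set.inter_iUnion, Set.iUnion_eq_empty]

lemma voidEvent_inter_voidEvent (Φ : Ω → Set X) (D E : Set X) :
    voidEvent Φ D ∩ voidEvent Φ E = voidEvent Φ (D ∪ E) := by
  ext ω
  simp only [voidEvent, Set.mem_inter_iff, Set.mem_ofPred_eq, Set.inter_union_distrib_left,
    Set.union_empty_iff]

/-- The void events of measurable subsets of `S`. -/
def voidEvents [MeasurableSpace X] (Φ : Ω → Set X) (S : Set X) : Set (Set Ω) :=
  {E | ∃ D, MeasurableSet D ∧ D ⊆ S ∧ voidEvent Φ D = E}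

/-- The `σ`-algebra generated by the void events of measurable subsets of `S`. -/
abbrev voidSigma [MeasurableSpace X] (Φ : Ω → Set X) (S : Set X) : MeasurableSpace Ω :=
  MeasurableSpace.generateFrom (voidEvents Φ S)

lemma isPiSystem_voidEvents [MeasurableSpace X] (Φ : Ω → Set X) (S : Set X) :
    IsPiSystem (voidEvents Φ S) := by
  rintro _ ⟨D, hD, hDS, rfl⟩ _ ⟨E, hE, hES, rfl⟩ -
  exact ⟨D ∪ E, hD.union hE, Set.union_subset hDS hES, (voidEvent_inter_voidEvent Φ D E).symm⟩

lemma measurableSet_voidSigma [MeasurableSpace X] (Φ : Ω → Set X) {S D : Set X}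
    (hD : MeasurableSet D) (hDS : D ⊆ S) : MeasurableSet[voidSigma Φ S] (voidEvent Φ D) :=
  MeasurableSpace.measurableSet_generateFrom ⟨D, hD, hDS, rfl⟩

lemma voidSigma_mono [MeasurableSpace X] (Φ : Ω → Set X) {S T : Set X} (h : S ⊆ T) :
    voidSigma Φ S ≤ voidSigma Φ T :=
  MeasurableSpace.generateFrom_mono fun _ ⟨D, hD, hDS, hE⟩ => ⟨D, hD, hDS.trans h, hE⟩

open Classical in
/-- The set of indices `i` for which `D i` contains no point of `Φ`. -/
noncomputable def voidPattern {ι : Type*} [Fintype ι] (Φ : Ω → Set X) (D : ι → Set X) (ω : Ω) :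
    Finset ι :=
  Finset.univ.filter fun i => Φ ω ∩ D i = ∅

lemma mem_voidPattern {ι : Type*} [Fintype ι] {Φ : Ω → Set X} {D : ι → Set X} {ω : Ω} {i : ι} :
    i ∈ voidPattern Φ D ω ↔ Φ ω ∩ D i = ∅ := by simp [voidPattern]

lemma voidPattern_preimage_supersets {ι : Type*} [Fintype ι] (Φ : Ω → Set X) (D : ι → Set X)
    (S : Finset ι) :
    voidPattern Φ D ⁻¹' {T | S ⊆ T} = voidEvent Φ (⋃ i ∈ S, D i) := by
  rw [← biInter_voidEvent]
  ext ω
  simp [voidEvent, Finset.subset_iff, mem_voidPattern]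

lemma measurableSet_voidPattern_preimage {ι : Type*} [Fintype ι] [MeasurableSpace X]
    (Φ : Ω → Set X) {D : ι → Set X} {S : Set X} (hD : ∀ i, MeasurableSet (D i))
    (hDS : ∀ i, D i ⊆ S) (E : Set (Finset ι)) :
    MeasurableSet[voidSigma Φ S] (voidPattern Φ D ⁻¹' E) := by
  have key : ∀ T : Finset ι, MeasurableSet[voidSigma Φ S] (voidPattern Φ D ⁻¹' {T}) := by
    intro T
    have : voidPattern Φ D ⁻¹' {T} = ⋂ i, {ω | i ∈ voidPattern Φ D ω ↔ i ∈ T} := by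
      ext ω
      simp [Finset.ext_iff]
    rw [this]
    refine MeasurableSet.iInter fun i => ?_
    have hi := measurableSet_voidSigma Φ (hD i) (hDS i)
    by_cases h : i ∈ T
    · simp only [h, iff_true, mem_voidPattern]
      exact hi
    · simp only [h, iff_false, mem_voidPattern]
      exact hi.compl
  have : voidPattern Φ D ⁻¹' E = ⋃ T ∈ E, voidPattern Φ D ⁻¹' {T} := by
    ext ω; simp
  rw [this]
  exact MeasurableSet.biUnion E.to_countable fun T _ => key T

/-- The events `S ⊆ T` correspond to void events of unions, whose probabilities are explicit. They
generate because a singleton consists of the supersets of `T` that contain no further element. -/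
lemma generateFrom_supersets (ι : Type*) [Fintype ι] :
    (⊤ : MeasurableSpace (Finset ι)) =
      MeasurableSpace.generateFrom (Set.range fun S : Finset ι => {T | S ⊆ T}) := by
  classical
  refine le_antisymm (fun E _ => ?_) le_top
  rw [← Set.biUnion_of_singleton E]
  refine MeasurableSet.biUnion E.to_countable fun T _ => ?_
  have hgen : ∀ S : Finset ι, MeasurableSet[MeasurableSpace.generateFrom
      (Set.range fun S : Finset ι => {T | S ⊆ T})] {T | S ⊆ T} := fun S =>
    MeasurableSpace.measurableSet_generateFrom ⟨S, rfl⟩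
  have : ({T} : Set (Finset ι)) = {U | T ⊆ U} \ ⋃ i ∈ Tᶜ, {U | insert i T ⊆ U} := by
    ext U
    simp only [Set.mem_singleton_iff, Set.mem_sdiff, Set.mem_ofPred_eq, Set.mem_iUnion,
      Finset.mem_compl, Finset.insert_subset_iff, not_exists, not_and]
    constructor
    · rintro rfl
      exact ⟨subset_rfl, fun i hi h => absurd h hi⟩
    · rintro ⟨h1, h2⟩
      refine Finset.Subset.antisymm (fun i hi => ?_) h1
      by_contra hT
      exact h2 i hT hi h1
  rw [this]
  exact (hgen T).diff ((Tᶜ).measurableSet_biUnion fun i _ => hgen _)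

variable [MeasurableSpace Ω] [MeasurableSpace X] {Φ : Ω → Set X} {ν : Measure X} {P : Measure Ω}

lemma IsPoissonProcess.measurableSet_voidEvent (hΦ : IsPoissonProcess Φ ν P) {D : Set X}
    (hD : MeasurableSet D) : MeasurableSet (voidEvent Φ D) := by
  have : voidEvent Φ D = (fun ω => (Φ ω ∩ D).encard) ⁻¹' {0} := by
    ext ω; simp [voidEvent]
  rw [this]
  exact hΦ.measurable_count D hD (measurableSet_singleton 0)

lemma IsPoissonProcess.voidSigma_le (hΦ : IsPoissonProcess Φ ν P) (S : Set X) :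
    voidSigma Φ S ≤ ‹MeasurableSpace Ω› :=
  MeasurableSpace.generateFrom_le fun _ ⟨_, hD, _, hE⟩ => hE ▸ hΦ.measurableSet_voidEvent hD

lemma IsPoissonProcess.measure_voidEvent (hΦ : IsPoissonProcess Φ ν P) {D : Set X}
    (hD : MeasurableSet D) (hfin : ν D < ∞) :
    P (voidEvent Φ D) = ENNReal.ofReal (Real.exp (-ν.real D)) := by
  have h1 : voidEvent Φ D = (fun ω => (Φ ω ∩ D).encard) ⁻¹' {0} := by
    ext ω; simp [voidEvent]
  have h2 : (fun k : ℕ => (k : ℕ∞)) ⁻¹' {0} = {0} := by ext k; simp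
  rw [h1, ← Measure.map_apply (hΦ.measurable_count D hD) (measurableSet_singleton 0),
    hΦ.law_count D hD hfin, Measure.map_apply (measurable_of_countable _)
    (measurableSet_singleton 0), h2, poissonMeasure_singleton]
  simp [measureReal_def, ENNReal.toReal]

/-- The configurations of a Poisson process in disjoint sets are independent. -/
lemma IsPoissonProcess.iIndep_voidSigma [IsProbabilityMeasure P] (hΦ : IsPoissonProcess Φ ν P)
    {ι : Type*} (S : ι → Set X) (hfin : ∀ i, ν (S i) < ∞)
    (hdisj : Pairwise fun i j => Disjoint (S i) (S j)) :
    iIndep (fun i => voidSigma Φ (S i)) P := by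
  refine iIndepSets.iIndep (fun i => hΦ.voidSigma_le _) (fun i => voidEvents Φ (S i))
    (fun i => isPiSystem_voidEvents Φ _) (fun i => rfl) ((iIndepSets_iff _ _).2 ?_)
  intro s f hf
  -- Indices outside `s` receive the empty set, so that the choice is defined for every index.
  have hfD : ∀ i, ∃ D, MeasurableSet D ∧ D ⊆ S i ∧ (i ∈ s → f i = voidEvent Φ D) := by
    intro i
    by_cases hi : i ∈ s
    · obtain ⟨D, hD, hDS, hE⟩ := hf i hi
      exact ⟨D, hD, hDS, fun _ => hE.symm⟩
    · exact ⟨∅, MeasurableSet.empty, Set.empty_subset _, fun h => absurd h hi⟩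
  choose D hD hDS hfD using hfD
  have hDfin : ∀ i, ν (D i) < ∞ := fun i => (measure_mono (hDS i)).trans_lt (hfin i)
  have e1 : ⋂ i ∈ s, f i = voidEvent Φ (⋃ i ∈ s, D i) := by
    rw [← biInter_voidEvent]
    exact Set.iInter₂_congr fun i hi => hfD i hi
  -- The intersection of the void events is the void event of a disjoint union; the exponential
  -- turns additivity of `ν` into a product.
  rw [e1, hΦ.measure_voidEvent (s.measurableSet_biUnion fun i _ => hD i)
    (measure_biUnion_lt_top s.finite_toSet fun i _ => hDfin i),
    measureReal_biUnion_finset (fun i _ j _ hij => (hdisj hij).mono (hDS i) (hDS j))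
      (fun i _ => hD i) (fun i _ => (hDfin i).ne), ← Finset.sum_neg_distrib, Real.exp_sum,
    ENNReal.ofReal_prod_of_nonneg fun i _ => (Real.exp_pos _).le]
  refine Finset.prod_congr rfl fun i hi => ?_
  rw [hfD i hi, hΦ.measure_voidEvent (hD i) (hDfin i)]

/-- The law of a void pattern is determined by the intensities of the finite unions. -/
lemma IsPoissonProcess.measure_voidPattern_congr [IsProbabilityMeasure P]
    (hΦ : IsPoissonProcess Φ ν P) {ι : Type*} [Fintype ι] {D D' : ι → Set X}
    (hD : ∀ i, MeasurableSet (D i)) (hD' : ∀ i, MeasurableSet (D' i))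
    (hfin : ∀ i, ν (D i) < ∞)
    (h : ∀ S : Finset ι, ν (⋃ i ∈ S, D i) = ν (⋃ i ∈ S, D' i)) (E : Set (Finset ι)) :
    P (voidPattern Φ D ⁻¹' E) = P (voidPattern Φ D' ⁻¹' E) := by
  let _ : MeasurableSpace (Finset ι) := ⊤
  have hm : ∀ {D : ι → Set X}, (∀ i, MeasurableSet (D i)) → Measurable (voidPattern Φ D) :=
    fun hD E _ => hΦ.voidSigma_le Set.univ _
      (measurableSet_voidPattern_preimage Φ hD (fun i => Set.subset_univ _) E)
  have key : P.map (voidPattern Φ D) = P.map (voidPattern Φ D') := by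
    have : IsProbabilityMeasure (P.map (voidPattern Φ D)) :=
      Measure.isProbabilityMeasure_map (hm hD).aemeasurable
    have : IsProbabilityMeasure (P.map (voidPattern Φ D')) :=
      Measure.isProbabilityMeasure_map (hm hD').aemeasurable
    refine ext_of_generate_finite _ (generateFrom_supersets ι) ?_ ?_ (by simp)
    · classical
      rintro _ ⟨S, rfl⟩ _ ⟨T, rfl⟩ -
      refine ⟨S ∪ T, ?_⟩
      ext U
      simp [Finset.union_subset_iff]
    · rintro _ ⟨S, rfl⟩
      have hSfin : ν (⋃ i ∈ S, D i) < ∞ :=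
        measure_biUnion_lt_top S.finite_toSet fun i _ => hfin i
      rw [Measure.map_apply (hm hD) trivial, Measure.map_apply (hm hD') trivial,
        voidPattern_preimage_supersets, voidPattern_preimage_supersets,
        hΦ.measure_voidEvent (S.measurableSet_biUnion fun i _ => hD i) hSfin,
        hΦ.measure_voidEvent (S.measurableSet_biUnion fun i _ => hD' i) (h S ▸ hSfin)]
      simp only [measureReal_def, h S]
  rw [← Measure.map_apply (hm hD) trivial, key, Measure.map_apply (hm hD') trivial]

end Void

/-! ### Potential positions of the tree and the regions of `𝔊` that decide them -/

section Positions

/-- The index of the `i`-th potential child of the box with index `j`, at a level `M + 1` higher.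
Only even offsets occur, so that distinct siblings are separated by a gap. -/
def child (M : ℕ) (j : Fin d → ℕ) (i : Fin d → Fin (2 ^ M)) : Fin d → ℕ :=
  fun t => 2 ^ (M + 1) * j t + 2 * i t

lemma child_div (M : ℕ) (j : Fin d → ℕ) (i : Fin d → Fin (2 ^ M)) (t : Fin d) :
    child M j i t / 2 ^ (M + 1) = j t := by
  have hi : 2 * (i t : ℕ) < 2 ^ (M + 1) := by
    have := (i t).2
    rw [pow_succ]; omega
  rw [child, Nat.mul_add_div (by positivity), Nat.div_eq_of_lt hi, add_zero]

lemma child_inj {M : ℕ} {j j' : Fin d → ℕ} {i i' : Fin d → Fin (2 ^ M)}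
    (h : child M j i = child M j' i') : j = j' ∧ i = i' := by
  have hj : j = j' := by
    funext t
    rw [← child_div M j i t, h, child_div]
  subst hj
  refine ⟨rfl, funext fun t => Fin.ext ?_⟩
  have := congrFun h t
  simp only [child] at this
  omega

lemma child_injective (M : ℕ) (j : Fin d → ℕ) : Function.Injective (child M j) :=
  fun _ _ h => (child_inj h).2

/-- The indices of the boxes that may appear in generation `l`. -/
def positions (d M : ℕ) : ℕ → Finset (Fin d → ℕ)
  | 0 => {0}
  | l + 1 => (positions d M l).biUnion fun j => Finset.univ.image (child M j)

lemma mem_positions_succ {M l : ℕ} {k : Fin d → ℕ} :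
    k ∈ positions d M (l + 1) ↔ ∃ j ∈ positions d M l, ∃ i, child M j i = k := by
  simp [positions]

lemma div_eq_zero_of_mem_positions {M l : ℕ} {k : Fin d → ℕ} (hk : k ∈ positions d M l)
    (t : Fin d) : k t / 2 ^ (l * (M + 1)) = 0 := by
  induction l generalizing k with
  | zero =>
    rw [positions, Finset.mem_singleton] at hk
    simp [hk]
  | succ l ih =>
    obtain ⟨j, hj, i, rfl⟩ := mem_positions_succ.1 hk
    rw [Nat.succ_mul, add_comm, pow_add, ← Nat.div_div_eq_div_mul, child_div]
    exact ih hj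

/-- After generation zero all coordinates are even, for cousins as well as siblings, so distinct
coordinates differ by at least two. -/
lemma exists_gap_of_mem_positions {M l : ℕ} {j k : Fin d → ℕ} (hj : j ∈ positions d M l)
    (hk : k ∈ positions d M l) (hjk : j ≠ k) : ∃ t, j t + 2 ≤ k t ∨ k t + 2 ≤ j t := by
  cases l with
  | zero =>
    rw [positions, Finset.mem_singleton] at hj hk
    exact absurd (hj.trans hk.symm) hjk
  | succ l =>
    obtain ⟨j, -, i, rfl⟩ := mem_positions_succ.1 hj
    obtain ⟨j', -, i', rfl⟩ := mem_positions_succ.1 hk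
    obtain ⟨t, ht⟩ := Function.ne_iff.1 hjk
    refine ⟨t, ?_⟩
    simp only [child, pow_succ'] at ht ⊢
    have e : ∀ a b : ℕ, 2 * 2 ^ M * a + 2 * b = 2 * (2 ^ M * a + b) := fun a b => by ring
    rw [e, e] at ht ⊢
    omega

lemma box_subset_box_succ {M l : ℕ} {j k : Fin d → ℕ} :
    box ((l + 1) * (M + 1)) k ⊆ box (l * (M + 1)) j ↔ ∀ t, k t / 2 ^ (M + 1) = j t := by
  rw [Nat.succ_mul]
  exact box_subset_box_iff

lemma box_child_subset (M l : ℕ) (j : Fin d → ℕ) (i : Fin d → Fin (2 ^ M)) :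
    box ((l + 1) * (M + 1)) (child M j i) ⊆ box (l * (M + 1)) j :=
  box_subset_box_succ.2 (child_div M j i)

lemma box_subset_unit {M l : ℕ} {k : Fin d → ℕ} (hk : k ∈ positions d M l) :
    box (l * (M + 1)) k ⊆ box 0 0 := by
  have := (box_subset_box_iff (m := 0) (r := l * (M + 1)) (j := 0) (k := k)).2
    fun t => div_eq_zero_of_mem_positions hk t
  rwa [zero_add] at this

/-- The sets that kill the `i`-th potential child of the box `j` of generation `l`. -/
def childShell (M l : ℕ) (j : Fin d → ℕ) (i : Fin d → Fin (2 ^ M)) : Set (SmallSet d) :=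
  shell (side ((l + 1) * (M + 1))) (side (l * (M + 1))) (box ((l + 1) * (M + 1)) (child M j i))

/-- The sets that may influence the offspring of the box `j` of generation `l`. -/
def parentShell (M l : ℕ) (j : Fin d → ℕ) : Set (SmallSet d) :=
  shell (side ((l + 1) * (M + 1))) (side (l * (M + 1))) (box (l * (M + 1)) j)

/-- The sets that may influence the first `l` generations. -/
def pastShell (d M l : ℕ) : Set (SmallSet d) := shell (side (l * (M + 1))) 1 (box 0 0)

lemma shell_mono {a a' b b' : ℝ} {A A' : Set (Space d)} (ha : a' ≤ a) (hb : b ≤ b')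
    (hA : A ⊆ A') : shell a b A ⊆ shell a' b' A' :=
  fun _ hG => ⟨hG.1.mono (Set.inter_subset_inter_right _ hA), ha.trans hG.2.1, hG.2.2.trans_le hb⟩

lemma childShell_subset_parentShell (M l : ℕ) (j : Fin d → ℕ) (i : Fin d → Fin (2 ^ M)) :
    childShell M l j i ⊆ parentShell M l j :=
  shell_mono le_rfl le_rfl (box_child_subset M l j i)

lemma parentShell_subset_pastShell {M l : ℕ} {j : Fin d → ℕ} (hj : j ∈ positions d M l) :
    parentShell M l j ⊆ pastShell d M (l + 1) :=
  shell_mono le_rfl (side_le_one _) (box_subset_unit hj)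

lemma pastShell_subset_succ (d M l : ℕ) : pastShell d M l ⊆ pastShell d M (l + 1) :=
  shell_mono (side_anti (Nat.mul_le_mul_right _ l.le_succ)) le_rfl subset_rfl

lemma disjoint_pastShell_parentShell (M l : ℕ) (j : Fin d → ℕ) :
    Disjoint (pastShell d M l) (parentShell M l j) :=
  Set.disjoint_left.2 fun _ h1 h2 => absurd h1.2.1 (not_le.2 h2.2.2)

/-- The gap between the boxes is at least their side, while the sets in these shells have strictly
smaller diameter and cannot bridge it. -/
lemma disjoint_parentShell {M l : ℕ} {j k : Fin d → ℕ} (hj : j ∈ positions d M l)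
    (hk : k ∈ positions d M l) (hjk : j ≠ k) :
    Disjoint (parentShell M l j) (parentShell M l k) := by
  refine Set.disjoint_left.2 fun G h1 h2 => absurd ?_ (not_le.2 h1.2.2)
  obtain ⟨t, ht | ht⟩ := exists_gap_of_mem_positions hj hk hjk
  · exact G.side_le_diam ht h1.1 h2.1
  · exact G.side_le_diam ht h2.1 h1.1

end Positions

/-! ### The embedded tree and its branching property -/

section Tree

lemma IsFractalModel.smul_shell_lt_top [MeasurableSpace (SmallSet d)]
    {μ : Measure (SmallSet d)} {lam : ℝ} (hμ : IsFractalModel μ) {a : ℝ} (ha : 0 < a) (b : ℝ)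
    {A : Set (Space d)} (hA : Bornology.IsBounded A) :
    (ENNReal.ofReal lam • μ) (shell a b A) < ∞ :=
  ENNReal.mul_lt_top ENNReal.ofReal_lt_top (hμ.measure_shell_lt_top ha b hA)

variable {Ω : Type*}

/-- The surviving children of the box `j` of generation `l`. -/
noncomputable def freeChildren (Φ : Ω → Set (SmallSet d)) (M l : ℕ) (j : Fin d → ℕ) (ω : Ω) :
    Finset (Fin d → Fin (2 ^ M)) :=
  voidPattern Φ (childShell M l j) ω

/-- The indices of the boxes in generation `l` of the embedded tree. -/
noncomputable def generation (Φ : Ω → Set (SmallSet d)) (M : ℕ) : ℕ → Ω → Finset (Fin d → ℕ)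
  | 0, _ => {0}
  | l + 1, ω => (generation Φ M l ω).biUnion fun j => (freeChildren Φ M l j ω).image (child M j)

lemma mem_generation_succ {Φ : Ω → Set (SmallSet d)} {M l : ℕ} {ω : Ω} {k : Fin d → ℕ} :
    k ∈ generation Φ M (l + 1) ω ↔
      ∃ j ∈ generation Φ M l ω, ∃ i ∈ freeChildren Φ M l j ω, child M j i = k := by
  simp [generation]

lemma generation_subset_positions (Φ : Ω → Set (SmallSet d)) (M l : ℕ) (ω : Ω) :
    generation Φ M l ω ⊆ positions d M l := by
  induction l with
  | zero => exact subset_rfl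
  | succ l ih =>
    intro k hk
    obtain ⟨j, hj, i, -, rfl⟩ := mem_generation_succ.1 hk
    exact mem_positions_succ.2 ⟨j, ih hj, i, rfl⟩

lemma card_generation_succ (Φ : Ω → Set (SmallSet d)) (M l : ℕ) (ω : Ω) :
    (generation Φ M (l + 1) ω).card
      = ∑ j ∈ generation Φ M l ω, (freeChildren Φ M l j ω).card := by
  rw [generation, Finset.card_biUnion]
  · exact Finset.sum_congr rfl fun j _ => Finset.card_image_of_injective _ (child_injective M j)
  · intro j _ j' _ hjj'
    refine Finset.disjoint_left.2 fun k hk hk' => hjj' ?_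
    obtain ⟨i, -, rfl⟩ := Finset.mem_image.1 hk
    obtain ⟨i', -, h⟩ := Finset.mem_image.1 hk'
    exact (child_inj h).1.symm

/-- A set as large as the parent box would also meet the parent, which is excluded by induction; a
smaller one would lie in the child's shell, which is void. The root is untouched because all
diameters are below one. -/
lemma box_mem_untouched {Φ : Ω → Set (SmallSet d)} {M l : ℕ} {ω : Ω} {k : Fin d → ℕ}
    (hk : k ∈ generation Φ M l ω) : box (l * (M + 1)) k ∈ untouched (Φ ω) (l * (M + 1)) := by
  refine ⟨⟨k, fun t => ?_, rfl⟩, ?_⟩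
  · have := div_eq_zero_of_mem_positions (generation_subset_positions Φ M l ω hk) t
    exact (Nat.div_eq_zero_iff_lt (by positivity)).1 this
  · induction l generalizing k with
    | zero =>
      rintro ⟨G, -, h1, -⟩
      refine absurd G.diam_lt_one (not_lt.2 ?_)
      simp only [atLeast, Set.mem_ofPred_eq, zero_mul, Nat.cast_zero, neg_zero, zpow_zero] at h1
      exact h1
    | succ l ih =>
      obtain ⟨j, hj, i, hi, rfl⟩ := mem_generation_succ.1 hk
      rintro ⟨G, hG, h1, h2⟩
      by_cases hGl : G ∈ atLeast d (l * (M + 1))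
      · exact ih hj ⟨G, hG, hGl, h2.mono (Set.inter_subset_inter_left _ (box_child_subset M l j i))⟩
      · have hmem : G ∈ Φ ω ∩ childShell M l j i :=
          ⟨hG, by rwa [Set.inter_comm] at h2, h1, not_le.1 hGl⟩
        rw [mem_voidPattern.1 hi] at hmem
        exact hmem

/-- The boxes in generation `l` of the embedded tree. -/
noncomputable def boxGeneration (Φ : Ω → Set (SmallSet d)) (M l : ℕ) (ω : Ω) :
    Finset (Set (Space d)) :=
  (generation Φ M l ω).map ⟨box (l * (M + 1)), box_injective _⟩

/-- Inclusion of boxes recovers the parent's index by integer division, so geometric and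
genealogical children agree. -/
lemma childCount_boxGeneration {Φ : Ω → Set (SmallSet d)} {M l : ℕ} {ω : Ω} {j : Fin d → ℕ}
    (hj : j ∈ generation Φ M l ω) :
    childCount (boxGeneration Φ M (l + 1) ω) (box (l * (M + 1)) j)
      = (freeChildren Φ M l j ω).card := by
  have : {B' | B' ∈ boxGeneration Φ M (l + 1) ω ∧ B' ⊆ box (l * (M + 1)) j}
      = (fun i => box ((l + 1) * (M + 1)) (child M j i)) '' (freeChildren Φ M l j ω : Set _) := by
    ext B
    simp only [boxGeneration, Finset.mem_map, Function.Embedding.coeFn_mk, Set.mem_ofPred_eq,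
      Set.mem_image, Finset.mem_coe]
    constructor
    · rintro ⟨⟨k, hk, rfl⟩, hB⟩
      obtain ⟨j', hj', i, hi, rfl⟩ := mem_generation_succ.1 hk
      have : j' = j := funext fun t => by rw [← child_div M j' i t, box_subset_box_succ.1 hB t]
      subst this
      exact ⟨i, hi, rfl⟩
    · rintro ⟨i, hi, rfl⟩
      exact ⟨⟨_, mem_generation_succ.2 ⟨j, hj, i, hi, rfl⟩, rfl⟩, box_child_subset M l j i⟩
  rw [childCount, this]
  exact (Set.ncard_image_of_injective _ ((box_injective _).comp (child_injective M j))).trans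
    (Set.ncard_coe_finset _)

variable [MeasurableSpace (SmallSet d)] [SuitableSigmaAlgebra d]

lemma measurableSet_childShell (M l : ℕ) (j : Fin d → ℕ) (i : Fin d → Fin (2 ^ M)) :
    MeasurableSet (childShell M l j i) := measurableSet_shell (isCompact_box _ _)

lemma measurableSet_freeChildren_preimage (Φ : Ω → Set (SmallSet d)) (M l : ℕ) (j : Fin d → ℕ)
    (E : Set (Finset (Fin d → Fin (2 ^ M)))) :
    MeasurableSet[voidSigma Φ (parentShell M l j)] (freeChildren Φ M l j ⁻¹' E) :=
  measurableSet_voidPattern_preimage Φ (measurableSet_childShell M l j)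
    (childShell_subset_parentShell M l j) E

lemma measurableSet_mem_generation (Φ : Ω → Set (SmallSet d)) (M l : ℕ) (k : Fin d → ℕ) :
    MeasurableSet[voidSigma Φ (pastShell d M l)] {ω | k ∈ generation Φ M l ω} := by
  induction l generalizing k with
  | zero =>
    simp only [generation]
    exact MeasurableSet.const _
  | succ l ih =>
    have : {ω | k ∈ generation Φ M (l + 1) ω} = ⋃ j ∈ positions d M l, ⋃ i,
        ⋃ (_ : child M j i = k), {ω | j ∈ generation Φ M l ω} ∩
          freeChildren Φ M l j ⁻¹' {T | i ∈ T} := by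
      ext ω
      simp only [Set.mem_ofPred_eq, mem_generation_succ, Set.mem_iUnion, Set.mem_inter_iff,
        Set.mem_preimage, exists_prop]
      constructor
      · rintro ⟨j, hj, i, hi, h⟩
        exact ⟨j, generation_subset_positions Φ M l ω hj, i, h, hj, hi⟩
      · rintro ⟨j, -, i, h, hj, hi⟩
        exact ⟨j, hj, i, hi, h⟩
    rw [this]
    refine (positions d M l).measurableSet_biUnion fun j hj => MeasurableSet.iUnion fun i =>
      MeasurableSet.iUnion fun _ => MeasurableSet.inter ?_ ?_
    · exact voidSigma_mono Φ (pastShell_subset_succ d M l) _ (ih j)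
    · exact voidSigma_mono Φ (parentShell_subset_pastShell hj) _
        (measurableSet_freeChildren_preimage Φ M l j _)

lemma measurableSet_generation_eq (Φ : Ω → Set (SmallSet d)) (M l : ℕ) (v : Finset (Fin d → ℕ)) :
    MeasurableSet[voidSigma Φ (pastShell d M l)] {ω | generation Φ M l ω = v} := by
  by_cases hv : v ⊆ positions d M l
  · have : {ω | generation Φ M l ω = v}
        = ⋂ k ∈ positions d M l, {ω | k ∈ generation Φ M l ω ↔ k ∈ v} := by
      ext ω
      simp only [Set.mem_ofPred_eq, Set.mem_iInter]
      constructor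
      · rintro h k -
        rw [h]
      · intro h
        ext k
        exact ⟨fun hk => (h k (generation_subset_positions Φ M l ω hk)).1 hk,
          fun hk => (h k (hv hk)).2 hk⟩
    rw [this]
    refine (positions d M l).measurableSet_biInter fun k _ => ?_
    have hk := measurableSet_mem_generation Φ M l k
    by_cases h : k ∈ v
    · simpa only [h, iff_true] using hk
    · simp only [h, iff_false]
      exact hk.compl
  · have : {ω | generation Φ M l ω = v} = ∅ := by
      ext ω
      simp only [Set.mem_ofPred_eq, Set.mem_empty_iff_false, iff_false]
      rintro rfl
      exact hv (generation_subset_positions Φ M l ω)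
    rw [this]
    exact @MeasurableSet.empty _ (_)

lemma measurableSet_history_eq (Φ : Ω → Set (SmallSet d)) (M l : ℕ)
    (v : ℕ → Finset (Fin d → ℕ)) :
    MeasurableSet[voidSigma Φ (pastShell d M l)] {ω | ∀ j ≤ l, generation Φ M j ω = v j} := by
  have hmono : Monotone (pastShell d M) := monotone_nat_of_le_succ (pastShell_subset_succ d M)
  have : {ω | ∀ j ≤ l, generation Φ M j ω = v j}
      = ⋂ j ∈ Finset.range (l + 1), {ω | generation Φ M j ω = v j} := by
    ext ω; simp
  rw [this]
  exact (Finset.range (l + 1)).measurableSet_biInter fun j hj =>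
    voidSigma_mono Φ (hmono (Nat.lt_succ_iff.1 (Finset.mem_range.1 hj))) _
      (measurableSet_generation_eq Φ M j (v j))

variable [MeasurableSpace Ω] {P : Measure Ω} {μ : Measure (SmallSet d)} {lam : ℝ}
  {Φ : Ω → Set (SmallSet d)}

/-- Given the first `l` generations, the offspring of the boxes in generation `l` are
independent. -/
lemma measure_past_inter_freeChildren [IsProbabilityMeasure P] (hμ : IsFractalModel μ)
    (hΦ : IsPoissonProcess Φ (ENNReal.ofReal lam • μ) P) {M l : ℕ} {A : Set Ω}
    (hA : MeasurableSet[voidSigma Φ (pastShell d M l)] A) {v : Finset (Fin d → ℕ)}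
    (hv : v ⊆ positions d M l)
    (E : (Fin d → ℕ) → Set (Finset (Fin d → Fin (2 ^ M)))) :
    P (A ∩ ⋂ j ∈ v, freeChildren Φ M l j ⁻¹' E j)
      = P A * ∏ j ∈ v, P (freeChildren Φ M l j ⁻¹' E j) := by
  -- The index `none` stands for the past and `some j` for the offspring of `j`, so one independent
  -- family covers both.
  let S : Option v → Set (SmallSet d) := fun o => o.elim (pastShell d M l)
    fun j => parentShell M l j
  let F : Option v → Set Ω := fun o => o.elim A fun j => freeChildren Φ M l j ⁻¹' E j
  have hind : iIndep (fun o => voidSigma Φ (S o)) P := by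
    refine hΦ.iIndep_voidSigma S ?_ ?_
    · rintro (_ | j) <;> exact hμ.smul_shell_lt_top (side_pos _) _ (isBounded_box _ _)
    · rintro (_ | j) (_ | k) hjk
      · exact absurd rfl hjk
      · exact disjoint_pastShell_parentShell M l k.1
      · exact Disjoint.symm (disjoint_pastShell_parentShell M l j.1)
      · exact disjoint_parentShell (hv j.2) (hv k.2) fun h => hjk (by rw [Subtype.ext h])
  have hF : ∀ o, MeasurableSet[voidSigma Φ (S o)] (F o) :=
    Option.rec hA fun j => measurableSet_freeChildren_preimage Φ M l j (E j)
  have key : P (⋂ o, F o) = ∏ o, P (F o) := hind.meas_iInter hF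
  rw [Fintype.prod_option] at key
  have e1 : ⋂ o, F o = A ∩ ⋂ j ∈ v, freeChildren Φ M l j ⁻¹' E j := by
    ext ω
    simp [F, Option.forall]
  rw [e1] at key
  rw [key]
  congr 1
  exact Finset.prod_coe_sort v fun j => P (freeChildren Φ M l j ⁻¹' E j)

/-- All boxes have the same offspring distribution. -/
lemma measure_freeChildren_preimage [IsProbabilityMeasure P] (hμ : IsFractalModel μ)
    (hΦ : IsPoissonProcess Φ (ENNReal.ofReal lam • μ) P) (M l : ℕ) (j : Fin d → ℕ)
    (E : Set (Finset (Fin d → Fin (2 ^ M)))) :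
    P (freeChildren Φ M l j ⁻¹' E) = P (freeChildren Φ M 0 0 ⁻¹' E) := by
  refine hΦ.measure_voidPattern_congr (measurableSet_childShell M l j)
    (measurableSet_childShell M 0 0)
    (fun i => hμ.smul_shell_lt_top (side_pos _) _ (isBounded_box _ _)) (fun S => ?_) E
  simp only [Measure.smul_apply]
  congr 1
  -- Scaling by `side (l * (M + 1))` carries the offspring regions of the root onto those of `j`.
  have := hμ.measure_biUnion_shell_box (a := side (M + 1)) (b := 1) (side_pos _) le_rfl
    (l * (M + 1)) (M + 1) j S fun i t => 2 * (i t : ℕ)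
  simp only [← side_add, mul_one] at this
  have hc : ∀ i : Fin d → Fin (2 ^ M), child M 0 i = fun t => 2 * (i t : ℕ) := fun i => by
    funext t; simp [child]
  simp only [childShell, Nat.succ_mul l, one_mul, zero_mul, zero_add, side_zero, hc]
  exact this

/-- The offspring distribution of the embedded tree. -/
noncomputable def offspringLaw (P : Measure Ω) [IsProbabilityMeasure P]
    (Φ : Ω → Set (SmallSet d)) (M : ℕ)
    (hΦ : AEMeasurable (fun ω => (freeChildren Φ M 0 0 ω).card) P) : PMF ℕ :=
  haveI := Measure.isProbabilityMeasure_map hΦ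
  (P.map fun ω => (freeChildren Φ M 0 0 ω).card).toPMF

lemma measurable_card_freeChildren (hΦ : IsPoissonProcess Φ (ENNReal.ofReal lam • μ) P)
    (M l : ℕ) (j : Fin d → ℕ) : Measurable fun ω => (freeChildren Φ M l j ω).card :=
  fun E _ => hΦ.voidSigma_le _ _
    (measurableSet_freeChildren_preimage Φ M l j {T | T.card ∈ E})

lemma offspringLaw_apply [IsProbabilityMeasure P] (hμ : IsFractalModel μ)
    (hΦ : IsPoissonProcess Φ (ENNReal.ofReal lam • μ) P) (M l : ℕ) (j : Fin d → ℕ) (k : ℕ) :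
    offspringLaw P Φ M (measurable_card_freeChildren hΦ M 0 0).aemeasurable k
      = P (freeChildren Φ M l j ⁻¹' {T | T.card = k}) := by
  rw [measure_freeChildren_preimage hμ hΦ, offspringLaw, Measure.toPMF_apply,
    Measure.map_apply (measurable_card_freeChildren hΦ M 0 0) (measurableSet_singleton k)]
  rfl

lemma isEmbeddedGaltonWatson_boxGeneration [IsProbabilityMeasure P] (hμ : IsFractalModel μ)
    (hΦ : IsPoissonProcess Φ (ENNReal.ofReal lam • μ) P) (M : ℕ) :
    IsEmbeddedGaltonWatson P Φ (M + 1)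
      (offspringLaw P Φ M (measurable_card_freeChildren hΦ M 0 0).aemeasurable)
      (boxGeneration Φ M) where
  root ω := by
    simp only [boxGeneration, generation, Finset.map_singleton, zero_mul]
    rfl
  untouched_mem l ω B hB := by
    obtain ⟨k, hk, rfl⟩ := Finset.mem_map.1 hB
    exact box_mem_untouched hk
  parent l ω B hB := by
    obtain ⟨k, hk, rfl⟩ := Finset.mem_map.1 hB
    obtain ⟨j, hj, i, -, rfl⟩ := mem_generation_succ.1 hk
    exact ⟨_, Finset.mem_map.2 ⟨j, hj, rfl⟩, box_child_subset M l j i⟩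
  measurable_generation l w := by
    by_cases hw : ∃ v : Finset (Fin d → ℕ), v.map ⟨box (l * (M + 1)), box_injective _⟩ = w
    · obtain ⟨v, rfl⟩ := hw
      simp only [boxGeneration, Finset.map_inj]
      exact hΦ.voidSigma_le _ _ (measurableSet_generation_eq Φ M l v)
    · have : {ω | boxGeneration Φ M l ω = w} = ∅ :=
        Set.eq_empty_of_forall_notMem fun ω hω => hw ⟨_, hω⟩
      rw [this]
      exact MeasurableSet.empty
  branching l w k := by
    -- If `w` is a possible history, a realisation `ω₀` translates it into index sets; otherwise
    -- both events are empty.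
    by_cases hw : ∃ ω₀, ∀ j ≤ l, boxGeneration Φ M j ω₀ = w j
    · obtain ⟨ω₀, hω₀⟩ := hw
      have e1 : {ω | ∀ j ≤ l, boxGeneration Φ M j ω = w j}
          = {ω | ∀ j ≤ l, generation Φ M j ω = generation Φ M j ω₀} := by
        ext ω
        refine forall₂_congr fun j hj => ?_
        rw [← hω₀ j hj, boxGeneration, boxGeneration, Finset.map_inj]
      have e2 : {ω | (∀ j ≤ l, boxGeneration Φ M j ω = w j) ∧
          ∀ B ∈ w l, childCount (boxGeneration Φ M (l + 1) ω) B = k B}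
          = {ω | ∀ j ≤ l, generation Φ M j ω = generation Φ M j ω₀} ∩
            ⋂ j ∈ generation Φ M l ω₀,
              freeChildren Φ M l j ⁻¹' {T | T.card = k (box (l * (M + 1)) j)} := by
        rw [← e1]
        ext ω
        refine and_congr_right fun h => ?_
        have hl : generation Φ M l ω = generation Φ M l ω₀ :=
          Finset.map_injective _ ((h l le_rfl).trans (hω₀ l le_rfl).symm)
        simp only [← hω₀ l le_rfl, boxGeneration, Finset.mem_map, Set.mem_iInter,
          Set.mem_preimage, Set.mem_ofPred_eq, forall_exists_index, and_imp,
          forall_apply_eq_imp_iff₂, Function.Embedding.coeFn_mk]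
        refine forall₂_congr fun j hj => ?_
        rw [← childCount_boxGeneration (hl ▸ hj)]
        rfl
      rw [e2, measure_past_inter_freeChildren hμ hΦ
        (measurableSet_history_eq Φ M l fun j => generation Φ M j ω₀)
        (generation_subset_positions Φ M l ω₀), e1, ← hω₀ l le_rfl, boxGeneration,
        Finset.prod_map]
      congr 1
      refine Finset.prod_congr rfl fun j _ => ?_
      rw [offspringLaw_apply hμ hΦ M l j]
      rfl
    · have e1 : {ω | ∀ j ≤ l, boxGeneration Φ M j ω = w j} = ∅ :=
        Set.eq_empty_of_forall_notMem fun ω hω => hw ⟨ω, hω⟩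
      have e2 : {ω | (∀ j ≤ l, boxGeneration Φ M j ω = w j) ∧
          ∀ B ∈ w l, childCount (boxGeneration Φ M (l + 1) ω) B = k B} = ∅ :=
        Set.eq_empty_of_forall_notMem fun ω hω => hw ⟨ω, hω.1⟩
      rw [e1, e2]
      simp

end Tree

/-! ### Exponential growth from first and second moments -/

section Growth

variable {Ω : Type*} [MeasurableSpace Ω] {P : Measure Ω} [IsProbabilityMeasure P]

/-- A random series of centred terms that converges absolutely in mean exceeds `-1` with positive
probability. -/
lemma measure_one_add_tsum_pos {F : ℕ → Ω → ℝ} (hF : ∀ l, Integrable (F l) P)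
    (hsum : Summable fun l => ∫ ω, ‖F l ω‖ ∂P) (hzero : ∀ l, ∫ ω, F l ω ∂P = 0) :
    0 < P {ω | Summable (fun l => F l ω) ∧ 0 < 1 + ∑' l, F l ω} := by
  have htop : ∑' l, ∫⁻ ω, ‖F l ω‖ₑ ∂P ≠ ∞ := by
    simp only [← ofReal_integral_norm_eq_lintegral_enorm (hF _)]
    exact hsum.tsum_ofReal_ne_top
  have hae : ∀ᵐ ω ∂P, Summable fun l => F l ω := by
    have := summable_norm_of_tsum_eLpNorm_ne_top (p := 1) le_rfl
      (fun l => (hF l).aestronglyMeasurable) (by simpa only [eLpNorm_one_eq_lintegral_enorm])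
    filter_upwards [this] with ω hω using hω.of_norm
  let Y : Ω → ℝ := fun ω => ∑' l, F l ω
  have hYint : Integrable Y P := by
    refine ⟨aestronglyMeasurable_of_tendsto_ae atTop
      (f := fun n ω => ∑ l ∈ Finset.range n, F l ω) (fun n => ?_) ?_, ?_⟩
    · exact (integrable_finsetSum _ fun l _ => hF l).aestronglyMeasurable
    · filter_upwards [hae] with ω hω using hω.hasSum.tendsto_sum_nat
    · calc ∫⁻ ω, ‖Y ω‖ₑ ∂P ≤ ∫⁻ ω, ∑' l, ‖F l ω‖ₑ ∂P :=
            lintegral_mono fun ω => enorm_tsum_le_tsum_enorm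
        _ = ∑' l, ∫⁻ ω, ‖F l ω‖ₑ ∂P :=
            lintegral_tsum fun l => (hF l).aestronglyMeasurable.enorm
        _ < ∞ := htop.lt_top
  have hY0 : ∫ ω, Y ω ∂P = 0 := by
    have := hasSum_integral_of_summable_integral_norm hF hsum
    simp only [hzero] at this
    exact this.unique hasSum_zero
  rw [pos_iff_ne_zero]
  -- Otherwise a variable of mean one would be nonpositive almost surely.
  intro h
  have hle : ∀ᵐ ω ∂P, 1 + Y ω ≤ 0 := by
    filter_upwards [hae, measure_eq_zero_iff_ae_notMem.1 h] with ω h1 h2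
    by_contra hc
    exact h2 ⟨h1, not_le.1 hc⟩
  have h1 : ∫ ω, (1 + Y ω) ∂P ≤ 0 := integral_nonpos_of_ae hle
  rw [integral_add (integrable_const _) hYint, hY0] at h1
  norm_num at h1

/-- A process of natural numbers whose increments have the first two moments of a supercritical
branching process grows at the expected exponential rate, with positive probability. -/
lemma measure_growth_pos {Z : ℕ → Ω → ℕ} {m v : ℝ} (hm : 1 < m) (hZ0 : ∀ ω, Z 0 ω = 1)
    (hint : ∀ l, Integrable (fun ω => (Z l ω : ℝ)) P)
    (hint2 : ∀ l, Integrable (fun ω => ((Z (l + 1) ω : ℝ) - m * Z l ω) ^ 2) P)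
    (hmean : ∀ l, ∫ ω, ((Z (l + 1) ω : ℝ) - m * Z l ω) ∂P = 0)
    (hvar : ∀ l, ∫ ω, ((Z (l + 1) ω : ℝ) - m * Z l ω) ^ 2 ∂P = v * ∫ ω, (Z l ω : ℝ) ∂P) :
    0 < P {ω | ∃ c : ℝ, 0 < c ∧ Tendsto (fun l => (Z l ω : ℝ) / m ^ l) atTop (𝓝 c)} := by
  have hm0 : 0 < m := one_pos.trans hm
  -- With `m = q^2` the standard deviation of the `l`-th increment is of order `q^l`, without
  -- fractional powers.
  obtain ⟨q, hq, rfl⟩ : ∃ q : ℝ, 1 < q ∧ m = q ^ 2 :=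
    ⟨√m, Real.lt_sqrt_of_sq_lt (by simpa using hm), (Real.sq_sqrt hm0.le).symm⟩
  have hq0 : 0 < q := one_pos.trans hq
  let D : ℕ → Ω → ℝ := fun l ω => (Z (l + 1) ω : ℝ) - q ^ 2 * Z l ω
  have hD : ∀ l, Integrable (D l) P := fun l => (hint (l + 1)).sub ((hint l).const_mul _)
  have hEZ : ∀ l, ∫ ω, (Z l ω : ℝ) ∂P = q ^ (2 * l) := by
    intro l
    induction l with
    | zero => simp [hZ0]
    | succ l ih =>
      have := hmean l
      rw [integral_sub (hint (l + 1)) ((hint l).const_mul _), integral_const_mul, ih] at this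
      rw [sub_eq_zero.1 this]; ring
  let F : ℕ → Ω → ℝ := fun l ω => D l ω / q ^ (2 * (l + 1))
  have hF : ∀ l, Integrable (F l) P := fun l => (hD l).div_const _
  -- The inequality `2|D| ≤ D²/q^l + q^l` with `E D² = v q^(2l)` bounds `E|D|` by `(v + 1)/2 * q^l`;
  -- the normalisation `q^(2(l+1))` then leaves geometric decay.
  have hbound : ∀ l, ∫ ω, ‖F l ω‖ ∂P ≤ (v + 1) / 2 * (1 / q) ^ l := by
    intro l
    have hql : 0 < q ^ l := pow_pos hq0 l
    calc ∫ ω, ‖F l ω‖ ∂P ≤ ∫ ω, (D l ω ^ 2 / q ^ l + q ^ l) / 2 / q ^ (2 * (l + 1)) ∂P := by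
          refine integral_mono (hF l).norm ?_ fun ω => ?_
          · exact ((((hint2 l).div_const _).add (integrable_const _)).div_const _).div_const _
          · simp only [F, norm_div, Real.norm_eq_abs, abs_of_pos (pow_pos hq0 (2 * (l + 1)))]
            gcongr
            rw [le_div_iff₀ two_pos, ← sq_abs, div_add' _ _ _ hql.ne', le_div_iff₀ hql]
            nlinarith [sq_nonneg (|D l ω| - q ^ l)]
      _ = (v * q ^ (2 * l) / q ^ l + q ^ l) / 2 / q ^ (2 * (l + 1)) := by
          rw [integral_div, integral_div, integral_add ((hint2 l).div_const _)
            (integrable_const _), integral_div, hvar l, hEZ l]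
          simp
      _ = (v + 1) / 2 * (1 / q) ^ l / q ^ 2 := by
          have e1 : q ^ (2 * l) = q ^ l * q ^ l := by ring
          have e2 : q ^ (2 * (l + 1)) = q ^ l * q ^ l * q ^ 2 := by ring
          rw [one_div, inv_pow, e1, e2]
          field_simp
      _ ≤ (v + 1) / 2 * (1 / q) ^ l := by
          have hv : 0 ≤ v := by
            have h0 := hvar 0
            rw [hEZ 0] at h0
            have : 0 ≤ ∫ ω, ((Z (0 + 1) ω : ℝ) - q ^ 2 * Z 0 ω) ^ 2 ∂P :=
              integral_nonneg fun ω => sq_nonneg _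
            simpa [h0] using this
          exact div_le_self (by positivity) (one_le_pow₀ hq.le)
  have hsum : Summable fun l => ∫ ω, ‖F l ω‖ ∂P := by
    refine Summable.of_nonneg_of_le (fun l => integral_nonneg fun ω => norm_nonneg _) hbound ?_
    exact (summable_geometric_of_lt_one (by positivity) (by rw [div_lt_one hq0]; exact hq)).mul_left
      _
  have hzero : ∀ l, ∫ ω, F l ω ∂P = 0 := fun l => by
    rw [integral_div, hmean l, zero_div]
  refine (measure_one_add_tsum_pos hF hsum hzero).trans_le (measure_mono ?_)
  rintro ω ⟨h1, h2⟩
  refine ⟨_, h2, ?_⟩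
  have htel : ∀ n, (Z n ω : ℝ) / (q ^ 2) ^ n = 1 + ∑ l ∈ Finset.range n, F l ω := by
    intro n
    induction n with
    | zero => simp [hZ0]
    | succ n ih =>
      rw [Finset.sum_range_succ, ← add_assoc, ← ih]
      simp only [F, D]
      field_simp
      ring
  simp only [htel]
  exact tendsto_const_nhds.add h1.hasSum.tendsto_sum_nat

/-- The root of `m^l` equals `g` exactly, and the root of `z l / m^l` tends to `c^0 = 1`. -/
lemma tendsto_rpow_of_tendsto_div_pow {z : ℕ → ℝ} {m g c : ℝ} {N : ℕ} (hN : N ≠ 0) (hg : 0 < g)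
    (hm : m = g ^ N) (hc : 0 < c) (h : Tendsto (fun l => z l / m ^ l) atTop (𝓝 c)) :
    Tendsto (fun l : ℕ => z l ^ (1 / ((l * N : ℕ) : ℝ))) atTop (𝓝 g) := by
  have hexp : Tendsto (fun l : ℕ => 1 / ((l * N : ℕ) : ℝ)) atTop (𝓝 0) := by
    simp only [one_div]
    exact (tendsto_inv_atTop_nhds_zero_nat (𝕜 := ℝ)).comp
      (tendsto_id.atTop_mul_const' (Nat.pos_of_ne_zero hN))
  have h1 := (h.rpow hexp (Or.inl hc.ne')).mul_const g
  rw [Real.rpow_zero, one_mul] at h1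
  refine h1.congr' ?_
  filter_upwards [eventually_gt_atTop 0, h.eventually (lt_mem_nhds hc)] with l hl hpos
  have hml : 0 < m ^ l := by rw [hm]; positivity
  have hlN : l * N ≠ 0 := Nat.mul_ne_zero hl.ne' hN
  have e1 : (m ^ l) ^ (1 / ((l * N : ℕ) : ℝ)) = g := by
    rw [hm, ← pow_mul, mul_comm N l, one_div, Real.pow_rpow_inv_natCast hg.le hlN]
  conv_rhs => rw [← div_mul_cancel₀ (z l) hml.ne', Real.mul_rpow hpos.le hml.le, e1]

end Growth

/-! ### Conditional mean and variance of the generation sizes -/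

section Moments

lemma IsPoissonProcess.indepFun_of_disjoint {Ω X : Type*} [MeasurableSpace Ω] {P : Measure Ω}
    [IsProbabilityMeasure P] [MeasurableSpace X] {Φ : Ω → Set X}
    {ν : Measure X} (hΦ : IsPoissonProcess Φ ν P) {S T : Set X} (hS : ν S < ∞) (hT : ν T < ∞)
    (hST : Disjoint S T) {f g : Ω → ℝ} (hf : Measurable[voidSigma Φ S] f)
    (hg : Measurable[voidSigma Φ T] g) : IndepFun f g P := by
  have hind : iIndep (fun b : Bool => voidSigma Φ (bif b then S else T)) P := by
    refine hΦ.iIndep_voidSigma (fun b : Bool => bif b then S else T) ?_ ?_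
    · rintro (_ | _)
      · exact hT
      · exact hS
    · rintro (_ | _) (_ | _) h
      · exact absurd rfl h
      · exact hST.symm
      · exact hST
      · exact absurd rfl h
  have h := hind.indep (show true ≠ false by decide)
  rw [IndepFun_iff_Indep]
  exact indep_of_indep_of_le h hf.comap_le hg.comap_le

variable {Ω : Type*}

/-- The indicator of the event that the box `j` belongs to generation `l`. -/
noncomputable def aliveIndicator (Φ : Ω → Set (SmallSet d)) (M l : ℕ) (j : Fin d → ℕ) :
    Ω → ℝ := Set.indicator {ω | j ∈ generation Φ M l ω} fun _ => 1

lemma abs_aliveIndicator_le (Φ : Ω → Set (SmallSet d)) (M l : ℕ) (j : Fin d → ℕ) (ω : Ω) :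
    |aliveIndicator Φ M l j ω| ≤ 1 := by
  unfold aliveIndicator Set.indicator; split_ifs <;> simp

lemma aliveIndicator_mul_self (Φ : Ω → Set (SmallSet d)) (M l : ℕ) (j : Fin d → ℕ) (ω : Ω) :
    aliveIndicator Φ M l j ω * aliveIndicator Φ M l j ω = aliveIndicator Φ M l j ω := by
  unfold aliveIndicator Set.indicator; split_ifs <;> simp

/-- This replaces a sum over a random index set by one over a deterministic set, through which
expectations can be taken. -/
lemma sum_aliveIndicator_mul (Φ : Ω → Set (SmallSet d)) (M l : ℕ) (ω : Ω)
    (f : (Fin d → ℕ) → ℝ) :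
    ∑ j ∈ positions d M l, aliveIndicator Φ M l j ω * f j = ∑ j ∈ generation Φ M l ω, f j := by
  rw [← Finset.sum_subset (generation_subset_positions Φ M l ω)]
  · refine Finset.sum_congr rfl fun j hj => ?_
    simp [aliveIndicator, hj]
  · intro j _ hj
    simp [aliveIndicator, hj]

lemma card_generation_eq_sum (Φ : Ω → Set (SmallSet d)) (M l : ℕ) (ω : Ω) :
    ((generation Φ M l ω).card : ℝ) = ∑ j ∈ positions d M l, aliveIndicator Φ M l j ω := by
  have := sum_aliveIndicator_mul Φ M l ω fun _ => 1
  simpa using this.symm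

variable [MeasurableSpace Ω]

/-- The mean number of children. -/
noncomputable def meanOffspring (P : Measure Ω) (Φ : Ω → Set (SmallSet d)) (M : ℕ) : ℝ :=
  ∫ ω, ((freeChildren Φ M 0 0 ω).card : ℝ) ∂P

/-- The centred number of children of the box `j` of generation `l`. -/
noncomputable def centredOffspring (P : Measure Ω) (Φ : Ω → Set (SmallSet d)) (M l : ℕ)
    (j : Fin d → ℕ) (ω : Ω) : ℝ :=
  (freeChildren Φ M l j ω).card - meanOffspring P Φ M

lemma card_generation_sub (P : Measure Ω) (Φ : Ω → Set (SmallSet d)) (M l : ℕ) (ω : Ω) :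
    ((generation Φ M (l + 1) ω).card : ℝ) - meanOffspring P Φ M * (generation Φ M l ω).card
      = ∑ j ∈ positions d M l, aliveIndicator Φ M l j ω * centredOffspring P Φ M l j ω := by
  rw [sum_aliveIndicator_mul, card_generation_succ]
  simp [centredOffspring, mul_comm]

lemma abs_centredOffspring_le (P : Measure Ω) (Φ : Ω → Set (SmallSet d)) (M l : ℕ)
    (j : Fin d → ℕ) (ω : Ω) : |centredOffspring P Φ M l j ω| ≤
      Fintype.card (Fin d → Fin (2 ^ M)) + |meanOffspring P Φ M| := by
  refine (abs_sub _ _).trans ?_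
  gcongr
  rw [Nat.abs_cast]
  exact_mod_cast Finset.card_le_univ _

variable [MeasurableSpace (SmallSet d)] [SuitableSigmaAlgebra d]

lemma measurable_centredOffspring (P : Measure Ω) (Φ : Ω → Set (SmallSet d)) (M l : ℕ)
    (j : Fin d → ℕ) :
    Measurable[voidSigma Φ (parentShell M l j)] (centredOffspring P Φ M l j) :=
  fun E _ => measurableSet_freeChildren_preimage Φ M l j
    {T | (T.card : ℝ) - meanOffspring P Φ M ∈ E}

lemma measurable_aliveIndicator {Ω : Type*} (Φ : Ω → Set (SmallSet d)) (M l : ℕ)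
    (j : Fin d → ℕ) : Measurable[voidSigma Φ (pastShell d M l)] (aliveIndicator Φ M l j) := by
  let _ : MeasurableSpace Ω := voidSigma Φ (pastShell d M l)
  exact measurable_const.indicator (measurableSet_mem_generation Φ M l j)

variable {P : Measure Ω} {μ : Measure (SmallSet d)} {lam : ℝ} {Φ : Ω → Set (SmallSet d)}

lemma measurable_aliveIndicator' (hΦ : IsPoissonProcess Φ (ENNReal.ofReal lam • μ) P)
    (M l : ℕ) (j : Fin d → ℕ) : Measurable (aliveIndicator Φ M l j) :=
  (measurable_aliveIndicator Φ M l j).mono (hΦ.voidSigma_le _) le_rfl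

lemma measurable_centredOffspring' (hΦ : IsPoissonProcess Φ (ENNReal.ofReal lam • μ) P)
    (M l : ℕ) (j : Fin d → ℕ) : Measurable (centredOffspring P Φ M l j) :=
  (measurable_centredOffspring P Φ M l j).mono (hΦ.voidSigma_le _) le_rfl

variable [IsProbabilityMeasure P]

/-- Moments of the offspring do not depend on the box. -/
lemma integral_comp_freeChildren (hμ : IsFractalModel μ)
    (hΦ : IsPoissonProcess Φ (ENNReal.ofReal lam • μ) P) (M l : ℕ) (j : Fin d → ℕ)
    (f : Finset (Fin d → Fin (2 ^ M)) → ℝ) :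
    ∫ ω, f (freeChildren Φ M l j ω) ∂P = ∫ ω, f (freeChildren Φ M 0 0 ω) ∂P := by
  let _ : MeasurableSpace (Finset (Fin d → Fin (2 ^ M))) := ⊤
  have hm : ∀ l j, Measurable (freeChildren Φ M l j) := fun l j E _ =>
    hΦ.voidSigma_le _ _ (measurableSet_freeChildren_preimage Φ M l j E)
  have hf : Measurable f := fun E _ => trivial
  have key : P.map (freeChildren Φ M l j) = P.map (freeChildren Φ M 0 0) := by
    ext E hE
    rw [Measure.map_apply (hm l j) hE, Measure.map_apply (hm 0 0) hE,
      measure_freeChildren_preimage hμ hΦ]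
  rw [← integral_map (hm l j).aemeasurable hf.aestronglyMeasurable, key,
    integral_map (hm 0 0).aemeasurable hf.aestronglyMeasurable]

lemma integrable_card_freeChildren (hΦ : IsPoissonProcess Φ (ENNReal.ofReal lam • μ) P)
    (M l : ℕ) (j : Fin d → ℕ) :
    Integrable (fun ω => ((freeChildren Φ M l j ω).card : ℝ)) P := by
  refine Integrable.of_bound
    (measurable_from_nat.comp (measurable_card_freeChildren hΦ M l j)).aestronglyMeasurable
    (Fintype.card (Fin d → Fin (2 ^ M))) (Eventually.of_forall fun ω => ?_)
  rw [Real.norm_natCast]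
  exact_mod_cast Finset.card_le_univ _

lemma integrable_aliveIndicator (hΦ : IsPoissonProcess Φ (ENNReal.ofReal lam • μ) P)
    (M l : ℕ) (j : Fin d → ℕ) : Integrable (aliveIndicator Φ M l j) P :=
  Integrable.of_bound (measurable_aliveIndicator' hΦ M l j).aestronglyMeasurable 1
    (Eventually.of_forall (abs_aliveIndicator_le Φ M l j))

lemma integral_centredOffspring (hμ : IsFractalModel μ)
    (hΦ : IsPoissonProcess Φ (ENNReal.ofReal lam • μ) P) (M l : ℕ) (j : Fin d → ℕ) :
    ∫ ω, centredOffspring P Φ M l j ω ∂P = 0 := by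
  unfold centredOffspring
  rw [integral_sub (integrable_card_freeChildren hΦ M l j) (integrable_const _),
    integral_comp_freeChildren hμ hΦ M l j fun T => (T.card : ℝ)]
  simp [meanOffspring]

lemma integrable_aliveIndicator_mul_centredOffspring
    (hΦ : IsPoissonProcess Φ (ENNReal.ofReal lam • μ) P) (M l : ℕ) (j : Fin d → ℕ) :
    Integrable (fun ω => aliveIndicator Φ M l j ω * centredOffspring P Φ M l j ω) P := by
  refine Integrable.of_bound ((measurable_aliveIndicator' hΦ M l j).mul
    (measurable_centredOffspring' hΦ M l j)).aestronglyMeasurable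
    (1 * (Fintype.card (Fin d → Fin (2 ^ M)) + |meanOffspring P Φ M|))
    (Eventually.of_forall fun ω => ?_)
  rw [norm_mul]
  exact mul_le_mul (abs_aliveIndicator_le Φ M l j ω) (abs_centredOffspring_le P Φ M l j ω)
    (norm_nonneg _) zero_le_one

lemma integrable_aliveIndicator_mul_centredOffspring_mul
    (hΦ : IsPoissonProcess Φ (ENNReal.ofReal lam • μ) P) (M l : ℕ) (j k : Fin d → ℕ) :
    Integrable (fun ω => aliveIndicator Φ M l j ω * centredOffspring P Φ M l j ω *
      (aliveIndicator Φ M l k ω * centredOffspring P Φ M l k ω)) P := by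
  refine (integrable_aliveIndicator_mul_centredOffspring hΦ M l j).mul_bdd
    (c := 1 * (Fintype.card (Fin d → Fin (2 ^ M)) + |meanOffspring P Φ M|))
    (integrable_aliveIndicator_mul_centredOffspring hΦ M l k).aestronglyMeasurable
    (Eventually.of_forall fun ω => ?_)
  rw [norm_mul]
  exact mul_le_mul (abs_aliveIndicator_le Φ M l k ω) (abs_centredOffspring_le P Φ M l k ω)
    (norm_nonneg _) zero_le_one

lemma integrable_card_generation (hΦ : IsPoissonProcess Φ (ENNReal.ofReal lam • μ) P)
    (M l : ℕ) : Integrable (fun ω => ((generation Φ M l ω).card : ℝ)) P := by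
  simp only [card_generation_eq_sum]
  exact integrable_finsetSum _ fun j _ => integrable_aliveIndicator hΦ M l j

/-- Conditionally on the past, the increments are centred. -/
lemma integral_card_generation_sub (hμ : IsFractalModel μ)
    (hΦ : IsPoissonProcess Φ (ENNReal.ofReal lam • μ) P) (M l : ℕ) :
    ∫ ω, (((generation Φ M (l + 1) ω).card : ℝ)
      - meanOffspring P Φ M * (generation Φ M l ω).card) ∂P = 0 := by
  simp only [card_generation_sub]
  rw [integral_finsetSum _ fun j _ => integrable_aliveIndicator_mul_centredOffspring hΦ M l j]
  refine Finset.sum_eq_zero fun j hj => ?_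
  have hind := hΦ.indepFun_of_disjoint (hμ.smul_shell_lt_top (side_pos _) _ (isBounded_box _ _))
    (hμ.smul_shell_lt_top (side_pos _) _ (isBounded_box _ _))
    (disjoint_pastShell_parentShell M l j) (measurable_aliveIndicator Φ M l j)
    (measurable_centredOffspring P Φ M l j)
  rw [hind.integral_fun_mul_eq_mul_integral
    (measurable_aliveIndicator' hΦ M l j).aestronglyMeasurable
    (measurable_centredOffspring' hΦ M l j).aestronglyMeasurable,
    integral_centredOffspring hμ hΦ, mul_zero]

lemma integrable_card_generation_sub_sq (hΦ : IsPoissonProcess Φ (ENNReal.ofReal lam • μ) P)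
    (M l : ℕ) :
    Integrable (fun ω => (((generation Φ M (l + 1) ω).card : ℝ)
      - meanOffspring P Φ M * (generation Φ M l ω).card) ^ 2) P := by
  simp only [card_generation_sub, sq, Finset.sum_mul_sum]
  exact integrable_finsetSum _ fun j _ => integrable_finsetSum _ fun k _ =>
    integrable_aliveIndicator_mul_centredOffspring_mul hΦ M l j k

/-- The centred offspring of `k` is independent of the past together with the offspring of `j`, and
has mean zero. -/
lemma integral_cross_eq_zero (hμ : IsFractalModel μ)
    (hΦ : IsPoissonProcess Φ (ENNReal.ofReal lam • μ) P) {M l : ℕ} {j k : Fin d → ℕ}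
    (hj : j ∈ positions d M l) (hk : k ∈ positions d M l) (hjk : j ≠ k) :
    ∫ ω, aliveIndicator Φ M l j ω * centredOffspring P Φ M l j ω *
      (aliveIndicator Φ M l k ω * centredOffspring P Φ M l k ω) ∂P = 0 := by
  have hpast : ∀ i : Fin d → ℕ, Measurable[voidSigma Φ (pastShell d M l ∪ parentShell M l j)]
      (aliveIndicator Φ M l i) := fun i =>
    (measurable_aliveIndicator Φ M l i).mono (voidSigma_mono Φ Set.subset_union_left) le_rfl
  have hcj : Measurable[voidSigma Φ (pastShell d M l ∪ parentShell M l j)]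
      (centredOffspring P Φ M l j) :=
    (measurable_centredOffspring P Φ M l j).mono (voidSigma_mono Φ Set.subset_union_right) le_rfl
  have hfin : ∀ i : Fin d → ℕ, (ENNReal.ofReal lam • μ) (parentShell M l i) < ∞ := fun i =>
    hμ.smul_shell_lt_top (side_pos _) _ (isBounded_box _ _)
  have hind := hΦ.indepFun_of_disjoint
    (measure_union_lt_top (hμ.smul_shell_lt_top (side_pos _) _ (isBounded_box _ _)) (hfin j))
    (hfin k)
    (Set.disjoint_union_left.2 ⟨disjoint_pastShell_parentShell M l k,
      disjoint_parentShell hj hk hjk⟩)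
    (((hpast j).mul hcj).mul (hpast k)) (measurable_centredOffspring P Φ M l k)
  have h1 : Measurable fun ω => aliveIndicator Φ M l j ω * centredOffspring P Φ M l j ω *
      aliveIndicator Φ M l k ω :=
    ((measurable_aliveIndicator' hΦ M l j).mul (measurable_centredOffspring' hΦ M l j)).mul
      (measurable_aliveIndicator' hΦ M l k)
  have h2 := hind.integral_mul_eq_mul_integral h1.aestronglyMeasurable
    (measurable_centredOffspring' hΦ M l k).aestronglyMeasurable
  rw [integral_centredOffspring hμ hΦ, mul_zero] at h2
  rw [← h2]
  congr 1
  funext ω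
  simp only [Pi.mul_apply]
  ring

/-- The conditional variance of the increments is proportional to the generation size. -/
lemma integral_card_generation_sub_sq (hμ : IsFractalModel μ)
    (hΦ : IsPoissonProcess Φ (ENNReal.ofReal lam • μ) P) (M l : ℕ) :
    ∫ ω, (((generation Φ M (l + 1) ω).card : ℝ)
      - meanOffspring P Φ M * (generation Φ M l ω).card) ^ 2 ∂P
      = (∫ ω, centredOffspring P Φ M 0 0 ω ^ 2 ∂P) *
        ∫ ω, ((generation Φ M l ω).card : ℝ) ∂P := by
  have hint := integrable_aliveIndicator_mul_centredOffspring_mul (P := P) hΦ M l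
  simp only [card_generation_sub, sq, Finset.sum_mul_sum]
  rw [integral_finsetSum _ fun j _ => integrable_finsetSum _ fun k _ => hint j k]
  simp only [card_generation_eq_sum]
  rw [integral_finsetSum _ fun j _ => integrable_aliveIndicator hΦ M l j, Finset.mul_sum]
  refine Finset.sum_congr rfl fun j hj => ?_
  rw [integral_finsetSum _ fun k _ => hint j k, Finset.sum_eq_single_of_mem j hj
    fun k hk hkj => integral_cross_eq_zero hμ hΦ hj hk hkj.symm]
  have hc := measurable_centredOffspring P Φ M l j
  have hind := hΦ.indepFun_of_disjoint (hμ.smul_shell_lt_top (side_pos _) _ (isBounded_box _ _))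
    (hμ.smul_shell_lt_top (side_pos _) _ (isBounded_box _ _))
    (disjoint_pastShell_parentShell M l j) (measurable_aliveIndicator Φ M l j) (hc.mul hc)
  have hc' := measurable_centredOffspring' hΦ M l j
  have h2 := hind.integral_mul_eq_mul_integral
    (measurable_aliveIndicator' hΦ M l j).aestronglyMeasurable (hc'.mul hc').aestronglyMeasurable
  have h3 := integral_comp_freeChildren hμ hΦ M l j
    fun T => ((T.card : ℝ) - meanOffspring P Φ M) * ((T.card : ℝ) - meanOffspring P Φ M)
  have h4 : ∫ ω, (centredOffspring P Φ M l j * centredOffspring P Φ M l j) ω ∂P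
      = ∫ ω, centredOffspring P Φ M 0 0 ω * centredOffspring P Φ M 0 0 ω ∂P := h3
  rw [h4] at h2
  refine Eq.trans ?_ (h2.trans (mul_comm _ _))
  congr 1
  funext ω
  simp only [Pi.mul_apply]
  linear_combination (centredOffspring P Φ M l j ω * centredOffspring P Φ M l j ω) *
    aliveIndicator_mul_self Φ M l j ω

/-- Along a supercritical embedded tree the growth rate is the mean number of children. -/
lemma measure_survivesWithGrowthRate_pos (hμ : IsFractalModel μ)
    (hΦ : IsPoissonProcess Φ (ENNReal.ofReal lam • μ) P) {M : ℕ} {g : ℝ} (hg : 1 < g)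
    (hmean : meanOffspring P Φ M = g ^ (M + 1)) :
    0 < P {ω | SurvivesWithGrowthRate (M + 1) (boxGeneration Φ M) g ω} := by
  have hm : 1 < meanOffspring P Φ M := hmean ▸ one_lt_pow₀ hg M.succ_ne_zero
  have key := measure_growth_pos (P := P) (Z := fun l ω => (generation Φ M l ω).card) hm
    (fun ω => by simp [generation]) (integrable_card_generation hΦ M)
    (integrable_card_generation_sub_sq hΦ M) (integral_card_generation_sub hμ hΦ M)
    (integral_card_generation_sub_sq hμ hΦ M)
  refine key.trans_le (measure_mono ?_)
  rintro ω ⟨c, hc, h⟩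
  refine ⟨fun l => ?_, ?_⟩
  · simp only [boxGeneration, Finset.map_nonempty]
    -- Extinction is permanent and would force the normalised size to tend to zero rather than to `c
    -- > 0`.
    by_contra hl
    have hzero : ∀ n, generation Φ M (l + n) ω = ∅ := by
      intro n
      induction n with
      | zero => exact Finset.not_nonempty_iff_eq_empty.1 hl
      | succ n ih => rw [← add_assoc, generation, ih, Finset.biUnion_empty]
    have h0 : Tendsto (fun k => ((generation Φ M k ω).card : ℝ) / meanOffspring P Φ M ^ k) atTop
        (𝓝 0) := by
      refine tendsto_const_nhds.congr' ?_
      filter_upwards [eventually_ge_atTop l] with k hk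
      obtain ⟨n, rfl⟩ := Nat.exists_eq_add_of_le hk
      simp [hzero]
    exact hc.ne' (tendsto_nhds_unique h h0)
  · simp only [boxGeneration, Finset.card_map]
    exact tendsto_rpow_of_tendsto_div_pow M.succ_ne_zero (one_pos.trans hg) hmean hc h

end Moments

/-! ### The mean number of children -/

section Mean

variable [MeasurableSpace (SmallSet d)] [SuitableSigmaAlgebra d] {Ω : Type*}
  [MeasurableSpace Ω] {P : Measure Ω} [IsProbabilityMeasure P] {μ : Measure (SmallSet d)}
  {lam : ℝ} {Φ : Ω → Set (SmallSet d)}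

/-- By linearity each of the `2^(M*d)` potential children contributes its void probability, and the
intensity of its shell is the dyadic sum of `measureReal_shell_box`. -/
lemma meanOffspring_eq (hlam : 0 ≤ lam) (hμ : IsFractalModel μ)
    (hΦ : IsPoissonProcess Φ (ENNReal.ofReal lam • μ) P) (M : ℕ) :
    meanOffspring P Φ M = ((2 : ℝ) ^ M) ^ d * Real.exp (-(lam *
      ∑ l ∈ Finset.range (M + 1), μ.real (shell (1 / 2) 1 (box (l + 1) (0 : Fin d → ℕ))))) := by
  have hmeas : ∀ i, MeasurableSet (voidEvent Φ (childShell M 0 0 i)) := fun i =>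
    hΦ.measurableSet_voidEvent (measurableSet_childShell M 0 0 i)
  have hcard : ∀ ω, ((freeChildren Φ M 0 0 ω).card : ℝ)
      = ∑ i, (voidEvent Φ (childShell M 0 0 i)).indicator (fun _ => (1 : ℝ)) ω := by
    intro ω
    simp [freeChildren, voidPattern, voidEvent, Set.indicator_apply]
  have hprob : ∀ i, ∫ ω, (voidEvent Φ (childShell M 0 0 i)).indicator (fun _ => (1 : ℝ)) ω ∂P
      = Real.exp (-(lam * ∑ l ∈ Finset.range (M + 1),
          μ.real (shell (1 / 2) 1 (box (l + 1) (0 : Fin d → ℕ))))) := by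
    intro i
    rw [integral_indicator_const _ (hmeas i), smul_eq_mul, mul_one, measureReal_def,
      hΦ.measure_voidEvent (measurableSet_childShell M 0 0 i)
        (hμ.smul_shell_lt_top (side_pos _) _ (isBounded_box _ _)),
      ENNReal.toReal_ofReal (Real.exp_pos _).le, measureReal_ennreal_smul_apply,
      ENNReal.toReal_ofReal hlam, ← hμ.measureReal_shell_box (M + 1) (child M 0 i)]
    simp only [childShell, zero_add, one_mul, zero_mul, side_zero]
  simp only [meanOffspring, hcard]
  rw [integral_finsetSum _ fun i _ => (integrable_const 1).indicator (hmeas i)]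
  simp [hprob]

lemma tsum_offspringLaw (hΦ : IsPoissonProcess Φ (ENNReal.ofReal lam • μ) P) (M : ℕ) :
    ∑' k : ℕ, (k : ℝ≥0∞) *
      offspringLaw P Φ M (measurable_card_freeChildren hΦ M 0 0).aemeasurable k
        = ENNReal.ofReal (meanOffspring P Φ M) := by
  have hm := measurable_card_freeChildren hΦ M 0 0
  simp only [offspringLaw, Measure.toPMF_apply]
  rw [← lintegral_countable', lintegral_map (measurable_of_countable _) hm, meanOffspring,
    ofReal_integral_eq_lintegral_ofReal (integrable_card_freeChildren hΦ M 0 0)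
      (Eventually.of_forall fun ω => Nat.cast_nonneg _)]
  simp

end Mean

end PoissonFractal

theorem corollary3p1 {d : ℕ} (hd : 1 ≤ d)
    [MeasurableSpace (SmallSet d)] [SuitableSigmaAlgebra d]
    (μ : Measure (SmallSet d)) (hμ : IsFractalModel μ)
    {Ω : Type*} [MeasurableSpace Ω] (P : Measure Ω) [IsProbabilityMeasure P]
    (lam : ℝ) (hlam_pos : 0 < lam)
    (hlam : lam < d * Real.log 2 / μ.real (originShell d 1))
    (Φ : Ω → Set (SmallSet d)) (hΦ : IsPoissonProcess Φ (ENNReal.ofReal lam • μ) P)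
    (ε : ℝ) (hε : 0 < ε) :
    ∃ (N : ℕ) (p : PMF ℕ) (W : ℕ → Ω → Finset (Set (Space d))) (g : ℝ),
      1 ≤ N ∧
      IsEmbeddedGaltonWatson P Φ N p W ∧
      ∑' k : ℕ, (k : ℝ≥0∞) * p k = ENNReal.ofReal (g ^ N) ∧
      1 < g ∧
      (2 : ℝ) ^ ((d : ℝ) - lam * (μ.real (originShell d 1) + ε) / Real.log 2) ≤ g ∧
      0 < P {ω | SurvivesWithGrowthRate N W g ω} := by
  set a : ℝ := μ.real (originShell d 1)
  have hlog2 : 0 < Real.log 2 := Real.log_pos one_lt_two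
  -- For `a = 0` the quotient in `hlam` is `0` by convention, contradicting `0 < lam`.
  have ha : 0 < a := by
    refine measureReal_nonneg.lt_of_ne fun h => ?_
    rw [show a = 0 from h.symm, div_zero] at hlam
    exact absurd hlam (not_lt.2 hlam_pos.le)
  rw [lt_div_iff₀ ha] at hlam
  let s : ℕ → ℝ := fun n => ∑ l ∈ Finset.range n,
    μ.real (shell (1 / 2) 1 (box (l + 1) (0 : Fin d → ℕ)))
  have hces : Tendsto (fun n : ℕ => (n⁻¹ : ℝ) * s n) atTop (𝓝 a) :=
    ((tendsto_add_atTop_iff_nat 1).2 hμ.tendsto_measureReal_shell).cesaro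
  -- At `n = M + 1` this is the logarithm of the mean per level; the loss `1/n` is the price of
  -- using only even offsets, one level per generation.
  have hL : Tendsto (fun n : ℕ => d * Real.log 2 * (1 - (n : ℝ)⁻¹) - lam * ((n⁻¹ : ℝ) * s n))
      atTop (𝓝 (d * Real.log 2 * (1 - 0) - lam * a)) :=
    ((tendsto_const_nhds.sub tendsto_inv_atTop_nhds_zero_nat).const_mul _).sub
      (hces.const_mul lam)
  rw [sub_zero, mul_one] at hL
  -- Exceeding `0` gives `1 < g`, and exceeding the second entry gives the asserted lower bound for
  -- `g`.
  have hmax : max 0 (d * Real.log 2 - lam * (a + ε)) < d * Real.log 2 - lam * a :=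
    max_lt (by linarith) (by nlinarith)
  obtain ⟨M, hM⟩ := ((tendsto_add_atTop_iff_nat 1).2 hL |>.eventually (lt_mem_nhds hmax)).exists
  obtain ⟨hM1, hM2⟩ := max_lt_iff.1 hM
  set L : ℝ := d * Real.log 2 * (1 - ((M + 1 : ℕ) : ℝ)⁻¹)
    - lam * (((M + 1 : ℕ) : ℝ)⁻¹ * s (M + 1))
  have hmean : meanOffspring P Φ M = Real.exp L ^ (M + 1) := by
    have hN : ((M + 1 : ℕ) : ℝ) ≠ 0 := Nat.cast_ne_zero.2 M.succ_ne_zero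
    have hexp : ((M + 1 : ℕ) : ℝ) * L = M * d * Real.log 2 + -(lam * s (M + 1)) := by
      simp only [L]
      field_simp
      push_cast
      ring
    rw [meanOffspring_eq hlam_pos.le hμ hΦ, ← Real.exp_nat_mul, hexp, Real.exp_add]
    congr 1
    rw [← pow_mul, ← Real.rpow_natCast, Real.rpow_def_of_pos two_pos]
    push_cast
    ring_nf
  have hg : 1 < Real.exp L := Real.one_lt_exp_iff.2 hM1
  refine ⟨M + 1, _, boxGeneration Φ M, Real.exp L, M.succ_pos,
    isEmbeddedGaltonWatson_boxGeneration hμ hΦ M, ?_, hg, ?_,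
    measure_survivesWithGrowthRate_pos hμ hΦ hg hmean⟩
  · rw [tsum_offspringLaw hΦ, hmean]
  · rw [Real.rpow_def_of_pos two_pos, Real.exp_le_exp]
    have : Real.log 2 * (d - lam * (a + ε) / Real.log 2) = d * Real.log 2 - lam * (a + ε) := by
      field_simp
    rw [this]
    exact hM2.le
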